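/- Let $K=\mathbb{Q}(i)$, with ring of integers $\mathbb{Z}[i]$. Let $f,g,h\in\mathbb{Z}[i]$ be squarefree and pairwise coprime, put $m=fg^2h^3$, let $\alpha$ be a fourth root of $m$, and let $N=K(\alpha)$. Assume that $[N:K]=4$. Let $\mathcal{O}_N$ be the ring of integers of $N$, i.e. the integral closure of $\mathbb{Z}[i]$ in $N$; an integral basis of $N/K$ is a basis of $\mathcal{O}_N$ as a $\mathbb{Z}[i]$-module. Congruences are in $\mathbb{Z}[i]$, and $|x|^2=x\bar{x}$. (1) The prime $(1+i)$ of $\mathbb{Z}[i]$ is unramified in $N/K$ (every prime of $\mathcal{O}_N$ above it has ramification index $1$) if and only if $m\equiv 1\pmod 8$ or $m\equiv 1+4i\pmod 8$. (2) If $m\equiv 1\pmod 8$, then an integral basis of $N/K$ is \[ \left\{1,\ \frac{1+\alpha}{1+i},\ \frac{|gh|^2\bigl(i+(1+i)\alpha\bigr)+\alpha^2}{2(1+i)gh},\ \frac{|gh^2|^2\bigl(1+\alpha+\alpha^2\bigr)+\alpha^3}{4gh^2}\right\}. \] (3) If $m\equiv 1+4i\pmod 8$, then an integral basis of $N/K$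 is \[ \left\{1,\ \frac{1+\alpha}{1+i},\ \frac{|gh|^2\bigl(-i+(1+i)\alpha\bigr)+\alpha^2}{2(1+i)gh},\ \frac{|gh^2|^2\bigl(2-i+\alpha+i\alpha^2\bigr)+\alpha^3}{4gh^2}\right\}. \] (4) If $m\equiv 1$ or $1+4i\pmod 8$, then the discriminant of $N/K$ is $f^3g^2h^3$: the integral basis in (2), respectively (3), has discriminant $\det\bigl(\mathrm{Tr}_{N/K}(b_jb_k)\bigr)=f^3g^2h^3$, and the relative discriminant ideal of $N/K$ is $(f^3g^2h^3)$. -/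

import Mathlib

noncomputable section

namespace QuarticKummer

/-- The imaginary unit of `ℤ[i]`. -/
def ι : GaussianInt := ⟨0, 1⟩

/-- The squared complex absolute value `|x|² = x * conj x` of a Gaussian integer,
again as a Gaussian integer. -/
def absSq (x : GaussianInt) : GaussianInt := x * star x

section Field

variable (N : Type*) [Field N] [Algebra GaussianInt N]

/-- The ring of integers of `N`: the integral closure of `ℤ[i]` in `N`. -/
abbrev ringOfInt : Subalgebra GaussianInt N := integralClosure GaussianInt N

/-- A prime ideal `P` of `ℤ[i]` is unramified in `N` if each prime `Q` of the ring of integers of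
`N` above `P` has ramification index `1`. -/
def IsUnramifiedOver (P : Ideal GaussianInt) : Prop :=
  ∀ Q : Ideal (ringOfInt N), Q.IsPrime → Q.LiesOver P → Q.ramificationIdx GaussianInt = 1

variable {N} in
/-- The family `v` is an integral basis: it consists of elements of the ring of integers of `N` and
is a basis of that ring as a `ℤ[i]`-module. -/
def IsIntegralBasis {κ : Type*} (v : κ → N) : Prop :=
  ∃ b : Module.Basis κ GaussianInt (ringOfInt N), ∀ j, (b j : N) = v j

/-- The relative discriminant ideal of `N / K`: the ideal of `ℤ[i]` generated by the discriminants
`det (Tr (bᵢ bⱼ))` of all `K`-bases of `N` that consist of integers of `N`. -/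
def relDiscr (K : Type*) [Field K] [Algebra GaussianInt K] [Algebra K N] : Ideal GaussianInt :=
  Ideal.span {d | ∃ b : Module.Basis (Fin (Module.finrank K N)) K N,
    (∀ j, b j ∈ ringOfInt N) ∧ algebraMap GaussianInt K d = Algebra.discr K b}

variable {N}

/-- `1, (1+α)/(1+ι), (|gh|²(ι+(1+ι)α)+α²)/(2(1+ι)gh), (|gh²|²(1+α+α²)+α³)/(4gh²)` -/
def basisOne (g h : GaussianInt) (α : N) : Fin 4 → N :=
  let c := algebraMap GaussianInt N
  ![1,
    (1 + α) / c (1 + ι),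
    (c (absSq (g * h)) * (c ι + c (1 + ι) * α) + α ^ 2) / c (2 * (1 + ι) * g * h),
    (c (absSq (g * h ^ 2)) * (1 + α + α ^ 2) + α ^ 3) / c (4 * g * h ^ 2)]

/-- `1, (1+α)/(1+ι), (|gh|²(-ι+(1+ι)α)+α²)/(2(1+ι)gh), (|gh²|²(2-ι+α+ια²)+α³)/(4gh²)` -/
def basisTwo (g h : GaussianInt) (α : N) : Fin 4 → N :=
  let c := algebraMap GaussianInt N
  ![1,
    (1 + α) / c (1 + ι),
    (c (absSq (g * h)) * (-c ι + c (1 + ι) * α) + α ^ 2) / c (2 * (1 + ι) * g * h),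
    (c (absSq (g * h ^ 2)) * (c (2 - ι) + α + c ι * α ^ 2) + α ^ 3) / c (4 * g * h ^ 2)]

end Field

end QuarticKummer

end

namespace QuarticKummer

/-! Write π = 1 + ι, so that π² = 2ι, π⁴ = -4 and ℤ[i]/π has two elements; call an element odd if π
does not divide it.

Discriminant. Each family arises from 1, α, α², α³ by a triangular matrix, so its discriminant is
-256m³ times the square of the product of the diagonal entries, which is d = f³g²h³
(`discr_triangularFamily`). Under either congruence d is odd.

Integrality. Away from π it suffices that α²/(gh) and α³/(gh²) have powers in ℤ[i]. At π put α = πβ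
- 1: then β is a root of a monic quartic over ℤ[i], the third element (with g = h = 1) is a root of
a monic quadratic over ℤ[i][β], and the fourth is a polynomial in these (`isIntegral_gamma_one`,
`isIntegral_gamma_two`). Both conditions are glued by |q|² ≡ 1 mod 4 for odd q
(`isIntegral_absSq_mul_add_div`).

Spanning. For an integer x of N, separating the eigencomponents of α ↦ ια puts 4x in the span of the
family (`four_smul_mem_span`), and Cramer's rule for the trace form puts dx there. As 4 and d are
coprime, x lies in the span.

Ramification. π is unramified iff it generates a radical ideal of the ring of integers
(`isUnramifiedOver_span_iff`). If d is odd, the trace form is nondegenerate mod π, while nilpotents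
mod π have trace 0, so the ideal is radical. Conversely (`eight_dvd_of_radical`), radicality lets π
be divided successively out of 1 + α and β² + β + c, where m = 1 - 4c; integrality of the quotients
forces 2 ∣ c(c + ι), hence c ≡ 0 or ι mod 2. -/

/-! ### Arithmetic of ℤ[i] at the prime 1 + ι -/

theorem ι_sq : ι ^ 2 = -1 := by
  ext <;> simp [ι, sq]

theorem one_add_ι_sq : (1 + ι) ^ 2 = 2 * ι := by
  linear_combination ι_sq

theorem one_add_ι_pow_four : (1 + ι) ^ 4 = -4 := by
  linear_combination ((1 + ι) ^ 2 + 2 * ι) * one_add_ι_sq + 4 * ι_sq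

theorem one_add_ι_dvd_iff (x : GaussianInt) : 1 + ι ∣ x ↔ Even (x.re + x.im) := by
  constructor
  · rintro ⟨y, rfl⟩
    exact ⟨y.re, by simp [ι]⟩
  · rintro ⟨t, ht⟩
    refine ⟨⟨t, x.im - t⟩, ?_⟩
    ext
    · simp [ι]; linarith
    · simp [ι]

theorem not_one_add_ι_dvd_one : ¬ (1 + ι) ∣ 1 := by
  rw [one_add_ι_dvd_iff]; simp

theorem one_add_ι_dvd_sub_one {x : GaussianInt} (hx : ¬ (1 + ι) ∣ x) : 1 + ι ∣ x - 1 := by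
  rw [one_add_ι_dvd_iff] at hx ⊢
  simp only [Zsqrtd.re_sub, Zsqrtd.im_sub, Zsqrtd.re_one, Zsqrtd.im_one]
  grind

/-- The residue ring has only the classes 0 and 1: if a is odd then a ≡ 1, so b ≡ ab ≡ 0. -/
theorem prime_one_add_ι : Prime (1 + ι) := by
  refine ⟨fun h => ?_, fun h => not_one_add_ι_dvd_one (h.dvd), fun a b hab => ?_⟩
  · have := congrArg Zsqrtd.re h
    simp [ι] at this
  · by_contra! hc
    obtain ⟨u, hu⟩ := one_add_ι_dvd_sub_one hc.1
    refine hc.2 ((dvd_add_right (c := b) (Dvd.intro (u * b) rfl)).1 ?_)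
    convert hab using 1
    linear_combination (-b) * hu

theorem one_add_ι_ne_zero : 1 + ι ≠ 0 := prime_one_add_ι.ne_zero

theorem isCoprime_one_add_ι {x : GaussianInt} (hx : ¬ (1 + ι) ∣ x) : IsCoprime (1 + ι) x := by
  obtain ⟨u, hu⟩ := one_add_ι_dvd_sub_one hx
  exact ⟨-u, 1, by linear_combination hu⟩

theorem isCoprime_four {x : GaussianInt} (hx : ¬ (1 + ι) ∣ x) : IsCoprime 4 x := by
  have := (isCoprime_one_add_ι hx).pow_left (m := 4)
  rwa [one_add_ι_pow_four, IsCoprime.neg_left_iff] at this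

/-- For odd x, |x|² is the sum of an even and an odd square. This is why the factors |gh|² and
|gh²|² in the bases are harmless at 1 + ι. -/
theorem four_dvd_absSq_sub_one {x : GaussianInt} (hx : ¬ (1 + ι) ∣ x) : 4 ∣ absSq x - 1 := by
  rw [one_add_ι_dvd_iff] at hx
  obtain ⟨t, ht⟩ : (4 : ℤ) ∣ x.re ^ 2 + x.im ^ 2 - 1 := by
    rcases Int.even_or_odd x.re with ⟨a, ha⟩ | ⟨a, ha⟩ <;>
      rcases Int.even_or_odd x.im with ⟨b, hb⟩ | ⟨b, hb⟩
    · exact absurd ⟨a + b, by rw [ha, hb]; ring⟩ hx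
    · exact ⟨a ^ 2 + b ^ 2 + b, by rw [ha, hb]; ring⟩
    · exact ⟨a ^ 2 + b ^ 2 + a, by rw [ha, hb]; ring⟩
    · exact absurd ⟨a + b + 1, by rw [ha, hb]; ring⟩ hx
  refine ⟨⟨t, 0⟩, ?_⟩
  ext
  · simp [absSq]; linarith
  · simp [absSq]; ring

theorem one_add_ι_dvd_two : 1 + ι ∣ 2 := ⟨1 - ι, by linear_combination ι_sq⟩

theorem not_one_add_ι_dvd_of_eight_dvd {m r : GaussianInt} (h : 8 ∣ m - (1 + 4 * r)) :
    ¬ (1 + ι) ∣ m := by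
  intro hm
  obtain ⟨k, hk⟩ := h
  obtain ⟨u, hu⟩ := hm
  obtain ⟨v, hv⟩ := one_add_ι_dvd_two
  refine not_one_add_ι_dvd_one ⟨u - v * (4 * k + 2 * r), ?_⟩
  linear_combination hu - hk - (4 * k + 2 * r) * hv

/-- The hypothesis reads 2 ∣ c(c + ι). The two factors differ by a unit and 2 is (1 + ι)² up to a
unit, so 2 divides one of them; and c + ι ≡ c - ι mod 2. -/
theorem two_dvd_or_two_dvd_sub_ι {c : GaussianInt} (h : 2 ∣ c - c ^ 2 - (1 + ι) * c) :
    2 ∣ c ∨ 2 ∣ c - ι := by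
  obtain ⟨d, hd⟩ := h
  have h1 := congrArg Zsqrtd.re hd
  have h2 := congrArg Zsqrtd.im hd
  simp [ι, sq] at h1 h2
  have key : Even c.re := by
    by_contra h0
    rw [Int.not_even_iff_odd] at h0
    obtain ⟨a, ha⟩ := h0
    rcases Int.even_or_odd c.im with ⟨b, hb⟩ | ⟨b, hb⟩ <;> rw [ha, hb] at h1 h2 <;>
      ring_nf at h1 h2 <;> omega
  obtain ⟨a, ha⟩ := key
  rcases Int.even_or_odd c.im with ⟨b, hb⟩ | ⟨b, hb⟩
  · exact Or.inl ⟨⟨a, b⟩, by ext <;> simp <;> linarith⟩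
  · exact Or.inr ⟨⟨a, b⟩, by ext <;> simp [ι] <;> linarith⟩

/-! ### Power-free elements and integrality criteria -/

/-- By coprimality p divides at most one of a, b, c, and that one exactly once, so its exponent in
the product is at most 3. -/
theorem not_prime_pow_four_dvd {R : Type*} [CommRing R] [IsDomain R] {a b c p : R}
    (ha : Squarefree a) (hb : Squarefree b) (hc : Squarefree c)
    (hab : IsCoprime a b) (hac : IsCoprime a c) (hbc : IsCoprime b c) (hp : Prime p) :
    ¬ p ^ 4 ∣ a * b ^ 2 * c ^ 3 := by
  intro h
  have hsq : ∀ {x : R}, Squarefree x → ¬ p ^ 2 ∣ x := fun hx hd =>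
    hp.not_isUnit (hx p (by rwa [← sq]))
  have hdvd : p ∣ a * b ^ 2 * c ^ 3 := (dvd_pow_self p (by norm_num)).trans h
  have cop : ∀ {x y : R}, IsCoprime x y → p ∣ x → ¬ p ∣ y := fun hxy hx hy =>
    hp.not_isUnit (hxy.isUnit_of_dvd' hx hy)
  have strip : ∀ {x y : R}, p ^ 4 ∣ x * y → ¬ p ∣ y → p ^ 4 ∣ x := fun hxy hy =>
    hp.pow_dvd_of_dvd_mul_right 4 hy hxy
  have powfree : ∀ {x : R}, Squarefree x → ¬ p ^ 4 ∣ x ^ 3 := by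
    intro x hx hd
    obtain ⟨y, rfl⟩ := hp.dvd_of_dvd_pow ((dvd_pow_self p (by norm_num)).trans hd)
    rw [mul_pow, show p ^ 4 = p ^ 3 * p by ring] at hd
    obtain ⟨z, rfl⟩ := hp.dvd_of_dvd_pow ((mul_dvd_mul_iff_left (pow_ne_zero 3 hp.ne_zero)).1 hd)
    exact hsq hx ⟨z, by ring⟩
  have npow : ∀ {x : R} (n : ℕ), ¬ p ∣ x → ¬ p ∣ x ^ n := fun n hx hd => hx (hp.dvd_of_dvd_pow hd)
  rcases hp.dvd_or_dvd hdvd with hd | hd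
  · rcases hp.dvd_or_dvd hd with hd | hd
    · have := strip (strip h (npow 3 (cop hac hd))) (npow 2 (cop hab hd))
      exact hsq ha ((pow_dvd_pow p (by norm_num)).trans this)
    · have hd := hp.dvd_of_dvd_pow hd
      have := strip h (npow 3 (cop hbc hd))
      rw [mul_comm] at this
      exact powfree hb ((strip this (cop hab.symm hd)).trans (pow_dvd_pow b (by norm_num)))
  · have hd := hp.dvd_of_dvd_pow hd
    rw [mul_comm, mul_comm a, ← mul_assoc] at h
    exact powfree hc (strip (strip h (cop hac.symm hd)) (npow 2 (cop hbc.symm hd)))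

/-- If `s` is not divisible by the `n`-th power of a prime and `w ^ n * s` is integral, then the
element `w` of the fraction field is integral. -/
theorem mem_range_of_pow_mul {R F : Type*} [CommRing R] [IsDomain R] [UniqueFactorizationMonoid R]
    [Field F] [Algebra R F] [IsFractionRing R F] {n : ℕ} {s : R}
    (hs : ∀ p : R, Prime p → ¬ p ^ n ∣ s)
    {w : F} (hw : IsIntegral R (w ^ n * algebraMap R F s)) : ∃ z, algebraMap R F z = w := by
  obtain ⟨t, ht⟩ := IsIntegrallyClosed.isIntegral_iff.1 hw
  obtain ⟨a, b, hab, rfl⟩ := IsFractionRing.exists_reduced_fraction (A := R) w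
  have hb : (b : R) ≠ 0 := nonZeroDivisors.ne_zero b.2
  have hb' : algebraMap R F b ≠ 0 := by simp
  rw [IsFractionRing.mk'_eq_div] at ht ⊢
  have key : a ^ n * s = b ^ n * t := by
    apply IsFractionRing.injective R F
    simp only [map_mul, map_pow]
    rw [ht, div_pow]; field_simp
  have hu : IsUnit (b : R) := by
    by_contra hu
    obtain ⟨p, hp, hpb⟩ := WfDvdMonoid.exists_irreducible_factor hu hb
    have hp := hp.prime
    refine hs p hp (hp.pow_dvd_of_dvd_mul_left n (fun h => ?_)
      (key ▸ (pow_dvd_pow_of_dvd hpb n).mul_right t))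
    exact hp.not_isUnit (hab (hp.dvd_of_dvd_pow h) hpb)
  obtain ⟨u, hu⟩ := hu
  refine ⟨a * ↑u⁻¹, ?_⟩
  rw [← hu] at hb' ⊢
  field_simp
  rw [← map_mul, mul_assoc, Units.inv_mul, mul_one]

/-- A Bézout relation recovers x from its two multiples. This replaces localization: it combines a
statement at 1 + ι with one away from it. -/
theorem mem_of_isCoprime_smul {R M : Type*} [CommRing R] [AddCommGroup M] [Module R M]
    (S : Submodule R M) {a b : R} (hab : IsCoprime a b) {x : M} (ha : a • x ∈ S) (hb : b • x ∈ S) :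
    x ∈ S := by
  obtain ⟨u, v, huv⟩ := hab
  have := S.add_mem (S.smul_mem u ha) (S.smul_mem v hb)
  rwa [smul_smul, smul_smul, ← add_smul, huv, one_smul] at this

theorem isIntegral_of_sq_eq {R B : Type*} [CommRing R] [CommRing B] [Algebra R B] {x a b : B}
    (ha : IsIntegral R a) (hb : IsIntegral R b) (hx : x ^ 2 = a * x + b) : IsIntegral R x := by
  have : IsIntegral (integralClosure R B) x := by
    refine ⟨Polynomial.X ^ 2 - Polynomial.C ⟨a, ha⟩ * Polynomial.X - Polynomial.C ⟨b, hb⟩,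
      by monicity!, ?_⟩
    simp [hx]
  exact isIntegral_trans x this

open Polynomial in
theorem minpoly_eq_X_pow_sub_C {F L : Type*} [Field F] [Field L] [Algebra F L] {n : ℕ} (hn : n ≠ 0)
    {a : F} {α : L} (hα : α ^ n = algebraMap F L a) (hL : IntermediateField.adjoin F {α} = ⊤)
    (hdeg : Module.finrank F L = n) : minpoly F α = X ^ n - C a := by
  have hfin : FiniteDimensional F L := Module.finite_of_finrank_pos (by omega)
  have hint : IsIntegral F α := IsIntegral.of_finite F α
  have hd : (minpoly F α).natDegree = n := by
    rw [← IntermediateField.adjoin.finrank hint, hL, IntermediateField.finrank_top', hdeg]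
  refine (eq_of_monic_of_dvd_of_natDegree_le (minpoly.monic hint) (monic_X_pow_sub_C a hn)
    (minpoly.dvd F α (by simp [hα])) ?_).symm
  rw [natDegree_X_pow_sub_C, hd]

/-! ### Traces and discriminants in a quartic Kummer extension -/

section Kummer

variable {F L : Type*} [Field F] [Field L] [Algebra F L] {a : F} {α : L}

theorem exists_powerBasis_gen_eq
    (hL : IntermediateField.adjoin F {α} = ⊤) (hdeg : Module.finrank F L = 4) :
    ∃ pb : PowerBasis F L, pb.gen = α ∧ pb.dim = 4 := by
  have hfin : FiniteDimensional F L := Module.finite_of_finrank_pos (by omega)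
  have hint : IsIntegral F α := IsIntegral.of_finite F α
  have htop : Algebra.adjoin F {α} = ⊤ := by
    rw [← IntermediateField.adjoin_simple_toSubalgebra_of_isAlgebraic hint.isAlgebraic, hL,
      IntermediateField.top_toSubalgebra]
  refine ⟨PowerBasis.ofAdjoinEqTop' hint htop, PowerBasis.ofAdjoinEqTop'_gen .., ?_⟩
  rw [← PowerBasis.finrank, hdeg]

theorem exists_coords
    (hL : IntermediateField.adjoin F {α} = ⊤) (hdeg : Module.finrank F L = 4)
    (x : L) :
    ∃ a : Fin 4 → F, x = algebraMap F L (a 0) +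
    algebraMap F L (a 1) * α + algebraMap F L (a 2) * α ^ 2 + algebraMap F L (a 3) * α ^ 3 := by
  obtain ⟨pb, rfl, hd⟩ := exists_powerBasis_gen_eq hL hdeg
  refine ⟨fun i => pb.basis.repr x (Fin.cast hd.symm i), ?_⟩
  conv_lhs => rw [← pb.basis.sum_repr x, ← (finCongr hd.symm).sum_comp]
  simp [Fin.sum_univ_four, Algebra.smul_def, pb.basis_eq_pow]

theorem exists_algEquiv_apply_eq (hα : α ^ 4 = algebraMap F L a)
    (hL : IntermediateField.adjoin F {α} = ⊤) (hdeg : Module.finrank F L = 4)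
    {i : F} (hi : i ^ 2 = -1) :
    ∃ σ : L ≃ₐ[F] L, σ α = algebraMap F L i * α := by
  have hfin : FiniteDimensional F L := Module.finite_of_finrank_pos (by omega)
  obtain ⟨pb, hgen, hd⟩ := exists_powerBasis_gen_eq hL hdeg
  have hroot : Polynomial.aeval (algebraMap F L i * α) (minpoly F pb.gen) = 0 := by
    rw [hgen, minpoly_eq_X_pow_sub_C four_ne_zero hα hL hdeg]
    have : algebraMap F L i ^ 4 = 1 := by
      rw [← map_pow, show i ^ 4 = 1 by linear_combination (i ^ 2 - 1) * hi, map_one]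
    simp [mul_pow, this, hα]
  refine ⟨AlgEquiv.ofBijective (pb.lift _ hroot) (AlgHom.bijective _), ?_⟩
  have := pb.lift_gen _ hroot
  rwa [hgen] at this

/-- The trace is invariant under σ : α ↦ iα, so Tr(αⁿ) = iⁿ Tr(αⁿ), which vanishes for n = 1, 2, 3
because iⁿ ≠ 1 there. -/
theorem trace_coords (hα : α ^ 4 = algebraMap F L a)
    (hL : IntermediateField.adjoin F {α} = ⊤) (hdeg : Module.finrank F L = 4)
    [NeZero (2 : F)] {i : F} (hi : i ^ 2 = -1) (a : Fin 4 → F) :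
    Algebra.trace F L (algebraMap F L (a 0) + algebraMap F L (a 1) * α +
      algebraMap F L (a 2) * α ^ 2 + algebraMap F L (a 3) * α ^ 3) = 4 * a 0 := by
  obtain ⟨σ, hσ⟩ := exists_algEquiv_apply_eq hα hL hdeg hi
  have h2 : (2 : F) ≠ 0 := NeZero.ne _
  have hpow : ∀ n : ℕ, Algebra.trace F L (α ^ n) = i ^ n * Algebra.trace F L (α ^ n) := fun n => by
    conv_lhs => rw [← Algebra.trace_eq_of_algEquiv σ, map_pow, hσ, mul_pow, ← map_pow,
      ← Algebra.smul_def, map_smul, smul_eq_mul]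
  have h1 : Algebra.trace F L α = 0 := by
    have := hpow 1
    rw [pow_one, pow_one] at this
    have h : 2 * Algebra.trace F L α = 0 := by
      linear_combination (1 + i) * this + Algebra.trace F L α * hi
    exact (mul_eq_zero.1 h).resolve_left h2
  have h22 : Algebra.trace F L (α ^ 2) = 0 := by
    have h : 2 * Algebra.trace F L (α ^ 2) = 0 := by
      linear_combination hpow 2 + Algebra.trace F L (α ^ 2) * hi
    exact (mul_eq_zero.1 h).resolve_left h2
  have h3 : Algebra.trace F L (α ^ 3) = 0 := by
    have h : 2 * Algebra.trace F L (α ^ 3) = 0 := by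
      linear_combination (1 - i) * hpow 3 + Algebra.trace F L (α ^ 3) * (i - i ^ 2 + 1) * hi
    exact (mul_eq_zero.1 h).resolve_left h2
  simp only [← Algebra.smul_def, map_add, map_smul, h1, h22, h3, Algebra.trace_algebraMap, hdeg]
  simp

theorem discr_pow_basis (hα : α ^ 4 = algebraMap F L a)
    (hL : IntermediateField.adjoin F {α} = ⊤) (hdeg : Module.finrank F L = 4)
    [NeZero (2 : F)] {i : F} (hi : i ^ 2 = -1) :
    Algebra.discr F ![1, α, α ^ 2, α ^ 3] = -256 * a ^ 3 := by
  have tr := trace_coords hα hL hdeg hi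
  have t0 : Algebra.trace F L 1 = 4 := by simpa using tr ![1, 0, 0, 0]
  have t1 : Algebra.trace F L α = 0 := by simpa using tr ![0, 1, 0, 0]
  have t2 : Algebra.trace F L (α ^ 2) = 0 := by simpa using tr ![0, 0, 1, 0]
  have t11 : Algebra.trace F L (α * α) = 0 := by rwa [← sq]
  have t3 : Algebra.trace F L (α ^ 3) = 0 := by simpa using tr ![0, 0, 0, 1]
  have t4 : Algebra.trace F L (α ^ 4) = 4 * a := by simpa [hα] using tr ![a, 0, 0, 0]
  have t5 : Algebra.trace F L (α ^ 5) = 0 := by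
    rw [show α ^ 5 = algebraMap F L a * α by rw [← hα]; ring]
    simpa using tr ![0, a, 0, 0]
  have t6 : Algebra.trace F L (α ^ 6) = 0 := by
    rw [show α ^ 6 = algebraMap F L a * α ^ 2 by rw [← hα]; ring]
    simpa using tr ![0, 0, a, 0]
  have : Algebra.traceMatrix F ![1, α, α ^ 2, α ^ 3] =
      !![4, 0, 0, 0; 0, 0, 0, 4 * a; 0, 0, 4 * a, 0; 0, 4 * a, 0, 0] := by
    ext j k
    rw [Algebra.traceMatrix_apply, Algebra.traceForm_apply]
    fin_cases j <;> fin_cases k <;>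
      simp [← pow_succ, ← pow_succ', ← pow_add, t0, t1, t11, t2, t3, t4, t5, t6]
  rw [Algebra.discr_def, this, Matrix.det_succ_row_zero]
  simp [Fin.sum_univ_succ, Matrix.det_fin_three, Fin.succAbove]
  ring

open scoped Matrix in
theorem discr_lowerTriangular (hα : α ^ 4 = algebraMap F L a)
    (hL : IntermediateField.adjoin F {α} = ⊤) (hdeg : Module.finrank F L = 4)
    [NeZero (2 : F)] {i : F} (hi : i ^ 2 = -1)
    (p₀ p₁ q₀ q₁ q₂ r₀ r₁ r₂ r₃ : F) :
    Algebra.discr F ![1, algebraMap F L p₀ + algebraMap F L p₁ * α,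
      algebraMap F L q₀ + algebraMap F L q₁ * α + algebraMap F L q₂ * α ^ 2,
      algebraMap F L r₀ + algebraMap F L r₁ * α + algebraMap F L r₂ * α ^ 2 +
        algebraMap F L r₃ * α ^ 3] = (p₁ * q₂ * r₃) ^ 2 * (-256 * a ^ 3) := by
  let P : Matrix (Fin 4) (Fin 4) F :=
    !![1, 0, 0, 0; p₀, p₁, 0, 0; q₀, q₁, q₂, 0; r₀, r₁, r₂, r₃]
  have hdet : P.det = p₁ * q₂ * r₃ := by
    simp [P, Matrix.det_succ_row_zero, Fin.sum_univ_succ, Fin.succAbove,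
      mul_assoc]
  rw [← discr_pow_basis hα hL hdeg hi, ← hdet, ← Algebra.discr_of_matrix_mulVec]
  congr 1
  ext j
  fin_cases j <;> simp [P, Matrix.mulVec, dotProduct, Fin.sum_univ_four]

end Kummer

/-- Cramer's rule for the trace form: the discriminant of a basis clears the denominators of an
element whose traces against that basis are integral. -/
theorem discr_smul_mem_span {R F L κ : Type*} [CommRing R] [IsIntegrallyClosed R]
    [Field F] [Algebra R F] [IsFractionRing R F] [Field L] [Algebra F L] [Algebra R L]
    [IsScalarTower R F L] [FiniteDimensional F L] [Fintype κ] [DecidableEq κ]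
    (b : Module.Basis κ F L) (hb : ∀ j, IsIntegral R (b j)) {d : R}
    (hd : algebraMap R F d = Algebra.discr F b) {x : L}
    (hx : ∀ j, IsIntegral R (Algebra.trace F L (x * b j))) :
    d • x ∈ Submodule.span R (Set.range b) := by
  have hG := Algebra.traceMatrix_of_basis_mulVec b x
  have hcr : Algebra.discr F b • b.equivFun x =
      (Algebra.traceMatrix F b).cramer (fun j => Algebra.trace F L (x * b j)) := by
    rw [← hG, Matrix.cramer_eq_adjugate_mulVec, Matrix.mulVec_mulVec, Matrix.adjugate_mul,
      Matrix.smul_mulVec, Matrix.one_mulVec, Algebra.discr_def]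
  have hmem : ∀ j, ∃ r : R, algebraMap R F r = Algebra.discr F b * b.repr x j := by
    intro j
    apply IsIntegrallyClosed.isIntegral_iff.1
    have := congrFun hcr j
    rw [Pi.smul_apply, smul_eq_mul, b.equivFun_apply] at this
    rw [this, Matrix.cramer_apply]
    refine IsIntegral.det fun k l => ?_
    rw [Matrix.updateCol_apply]
    split_ifs
    · exact hx k
    · exact Algebra.isIntegral_trace ((hb k).mul (hb l))
  choose r hr using hmem
  have : d • x = ∑ j, r j • b j := by
    conv_lhs => rw [← b.sum_repr x]
    rw [Finset.smul_sum]
    refine Finset.sum_congr rfl fun j _ => ?_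
    rw [← algebraMap_smul F d, ← algebraMap_smul F (r j), smul_smul, hd, hr]
  rw [this]
  exact Submodule.sum_mem _ fun j _ => Submodule.smul_mem _ _ (Submodule.subset_span ⟨j, rfl⟩)

/-! ### Integral elements at 1 + ι -/

section Integrality

variable {N : Type*} [Field N] [Algebra GaussianInt N] {α : N}

theorem algebraMap_ι_sq : algebraMap GaussianInt N ι ^ 2 = -1 := by
  rw [← map_pow, ι_sq, map_neg, map_one]

theorem isIntegral_of_pow_four_eq {m : GaussianInt} (hα : α ^ 4 = algebraMap GaussianInt N m) :
    IsIntegral GaussianInt α :=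
  IsIntegral.of_pow (n := 4) (by norm_num) (hα ▸ isIntegral_algebraMap)

variable [FaithfulSMul GaussianInt N]

theorem algebraMap_ne_zero {x : GaussianInt} (hx : x ≠ 0) : algebraMap GaussianInt N x ≠ 0 := by
  simpa using hx

theorem one_add_algebraMap_ι_ne_zero : (1 : N) + algebraMap GaussianInt N ι ≠ 0 := by
  have := algebraMap_ne_zero (N := N) one_add_ι_ne_zero
  rwa [map_add, map_one] at this

theorem two_ne_zero_of_gaussianInt : (2 : N) ≠ 0 := by
  have := algebraMap_ne_zero (N := N) (x := 2) (by decide)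
  rwa [map_ofNat] at this

/-- `(1 + α) / (1 + ι)` is a root of a monic polynomial with coefficients in `ℤ[i]`. -/
theorem quartic_of_one_add_div {c : GaussianInt}
    (hα : α ^ 4 = algebraMap GaussianInt N (1 - 4 * c)) {β : N}
    (hβ : (1 + algebraMap GaussianInt N ι) * β = 1 + α) :
    β ^ 4 + 2 * (algebraMap GaussianInt N ι - 1) * β ^ 3 - 3 * algebraMap GaussianInt N ι * β ^ 2 +
      (1 + algebraMap GaussianInt N ι) * β - algebraMap GaussianInt N c = 0 := by
  have hI := algebraMap_ι_sq (N := N)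
  have h4 : (4 : N) ≠ 0 := by
    have := two_ne_zero_of_gaussianInt (N := N)
    rw [show (4 : N) = 2 * 2 by norm_num]; exact mul_ne_zero this this
  simp only [map_sub, map_mul, map_one, map_ofNat] at hα
  generalize algebraMap GaussianInt N ι = I at *
  obtain rfl : α = (1 + I) * β - 1 := by linear_combination -hβ
  -- The relation is the expansion of (πβ - 1)⁴ = 1 - 4c with π = 1 + ι, divided by π⁴ = -4.
  refine (mul_eq_zero (a := (4 : N)).1 ?_).resolve_left h4
  have e4 : (1 + I) ^ 4 = -4 := by linear_combination (I ^ 2 + 4 * I + 5) * hI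
  have e3 : (1 + I) ^ 3 = 2 * I - 2 := by linear_combination (I + 3) * hI
  have e2 : (1 + I) ^ 2 = 2 * I := by linear_combination hI
  linear_combination -hα + β ^ 4 * e4 - 4 * β ^ 3 * e3 + 6 * β ^ 2 * e2

theorem isIntegral_one_add_div {c : GaussianInt}
    (hα : α ^ 4 = algebraMap GaussianInt N (1 - 4 * c)) {β : N}
    (hβ : (1 + algebraMap GaussianInt N ι) * β = 1 + α) : IsIntegral GaussianInt β := by
  have h := quartic_of_one_add_div hα hβ
  refine ⟨.X ^ 4 + .C (2 * (ι - 1)) * .X ^ 3 - .C (3 * ι) * .X ^ 2 + .C (1 + ι) * .X - .C c,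
    by monicity!, ?_⟩
  simpa [map_ofNat] using h

/-- Substituting α = (1 + ι)β - 1 gives (1 + ι)γ = ι(β² + ιβ). Squaring and reducing β⁴ by the
quartic for β with c = -2k yields a monic quadratic for γ over ℤ[i][β]. -/
theorem isIntegral_gamma_one {k : GaussianInt}
    (hα : α ^ 4 = algebraMap GaussianInt N (1 + 8 * k)) {γ : N}
    (hγ : (2 * (1 + algebraMap GaussianInt N ι)) * γ =
      algebraMap GaussianInt N ι + (1 + algebraMap GaussianInt N ι) * α + α ^ 2) :
    IsIntegral GaussianInt γ ∧ ∀ δ : N, 4 * δ = 1 + α + α ^ 2 + α ^ 3 →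
      IsIntegral GaussianInt δ := by
  have hI := algebraMap_ι_sq (N := N)
  have h2 := two_ne_zero_of_gaussianInt (N := N)
  have hπ := one_add_algebraMap_ι_ne_zero (N := N)
  have hii : IsIntegral GaussianInt (algebraMap GaussianInt N ι) := isIntegral_algebraMap
  have hα' : α ^ 4 = algebraMap GaussianInt N (1 - 4 * (-2 * k)) := by
    rw [hα]; congr 1; ring
  obtain ⟨β, hβ⟩ : ∃ β : N, (1 + algebraMap GaussianInt N ι) * β = 1 + α :=
    ⟨(1 + α) / (1 + algebraMap GaussianInt N ι), by field_simp⟩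
  have hq := quartic_of_one_add_div hα' hβ
  have hβi := isIntegral_one_add_div hα' hβ
  have hki : IsIntegral GaussianInt (algebraMap GaussianInt N k) := isIntegral_algebraMap
  have h2i : IsIntegral GaussianInt (2 : N) := by
    simpa only [map_ofNat] using isIntegral_algebraMap (R := GaussianInt) (A := N) (x := 2)
  simp only [map_mul, map_neg, map_ofNat] at hq
  generalize algebraMap GaussianInt N ι = I at *
  generalize algebraMap GaussianInt N k = k' at *
  obtain rfl : α = (1 + I) * β - 1 := by linear_combination -hβ
  have e1 : (1 + I) * γ = I * (β ^ 2 + I * β) := by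
    refine mul_left_cancel₀ h2 ?_
    grind
  have hγi : IsIntegral GaussianInt γ := by
    refine isIntegral_of_sq_eq (a := I - 2) (b := I * (β ^ 3 + β - k'))
      (hii.sub h2i) (hii.mul (((hβi.pow 3).add hβi).sub hki)) ?_
    refine mul_left_cancel₀ (mul_ne_zero hπ hπ) ?_
    grind
  refine ⟨hγi, fun δ hδ => ?_⟩
  have e4 : 4 * γ = 2 * (1 - I) * (I * (β ^ 2 + I * β)) := by
    linear_combination 2 * (1 - I) * e1 + 2 * γ * hI
  -- From 1 + α + α² + α³ = (1 + α)(α + ι)(α - ι), which equals 2(1 + ι)ι(β - 1)(β² + ιβ).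
  have : δ = I * (γ * (β - 1)) := by
    refine mul_left_cancel₀ (mul_ne_zero h2 h2) ?_
    clear e1 hq hπ h2 hα hα' hγ hβ
    grind only
  rw [this]
  exact hii.mul (hγi.mul (hβi.sub isIntegral_one))

/-- The same substitution, now with c = -ι - 2k; the changed sign of ι in γ gives (1 + ι)γ = ι(β² +
ιβ - 1). -/
theorem isIntegral_gamma_two {k : GaussianInt}
    (hα : α ^ 4 = algebraMap GaussianInt N (1 + 4 * ι + 8 * k)) {γ : N}
    (hγ : (2 * (1 + algebraMap GaussianInt N ι)) * γ =
      -algebraMap GaussianInt N ι + (1 + algebraMap GaussianInt N ι) * α + α ^ 2) :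
    IsIntegral GaussianInt γ ∧ ∀ δ : N,
      4 * δ = 2 - algebraMap GaussianInt N ι + α + algebraMap GaussianInt N ι * α ^ 2 + α ^ 3 →
        IsIntegral GaussianInt δ := by
  have hI := algebraMap_ι_sq (N := N)
  have h2 := two_ne_zero_of_gaussianInt (N := N)
  have hπ := one_add_algebraMap_ι_ne_zero (N := N)
  have hii : IsIntegral GaussianInt (algebraMap GaussianInt N ι) := isIntegral_algebraMap
  have hα' : α ^ 4 = algebraMap GaussianInt N (1 - 4 * (-ι - 2 * k)) := by
    rw [hα]; congr 1; ring
  obtain ⟨β, hβ⟩ : ∃ β : N, (1 + algebraMap GaussianInt N ι) * β = 1 + α :=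
    ⟨(1 + α) / (1 + algebraMap GaussianInt N ι), by field_simp⟩
  have hq := quartic_of_one_add_div hα' hβ
  have hβi := isIntegral_one_add_div hα' hβ
  have hki : IsIntegral GaussianInt (algebraMap GaussianInt N k) := isIntegral_algebraMap
  have h3i : IsIntegral GaussianInt (3 : N) := by
    simpa only [map_ofNat] using isIntegral_algebraMap (R := GaussianInt) (A := N) (x := 3)
  simp only [map_mul, map_sub, map_neg, map_ofNat] at hq
  generalize algebraMap GaussianInt N ι = I at *
  generalize algebraMap GaussianInt N k = k' at *
  obtain rfl : α = (1 + I) * β - 1 := by linear_combination -hβ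
  have e1 : (1 + I) * γ = I * (β ^ 2 + I * β - 1) := by
    refine mul_left_cancel₀ h2 ?_
    grind
  have hγi : IsIntegral GaussianInt γ := by
    refine isIntegral_of_sq_eq (a := -3) (b := I * (β ^ 3 + β - k') - (1 + I))
      h3i.neg ((hii.mul (((hβi.pow 3).add hβi).sub hki)).sub (isIntegral_one.add hii)) ?_
    refine mul_left_cancel₀ (mul_ne_zero hπ hπ) ?_
    grind
  refine ⟨hγi, fun δ hδ => ?_⟩
  have e4 : 4 * γ = 2 * (1 - I) * (I * (β ^ 2 + I * β - 1)) := by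
    linear_combination 2 * (1 - I) * e1 + 2 * γ * hI
  have : δ = β * (I * γ - I * β + (1 + I)) := by
    refine mul_left_cancel₀ (mul_ne_zero h2 h2) ?_
    clear e1 hq hπ h2 hα hα' hγ hβ
    grind only
  rw [this]
  exact hβi.mul (((hii.mul hγi).sub (hii.mul hβi)).add (isIntegral_one.add hii))

end Integrality

/-! ### Gluing integrality at and away from 1 + ι -/

section Lift

variable {N : Type*} [Field N] [Algebra GaussianInt N] [FaithfulSMul GaussianInt N]

/-- An element that is integral away from `1 + ι` and at `1 + ι` is integral. -/
theorem isIntegral_absSq_mul_add_div {p q : GaussianInt} (hp : p ∣ 4) (hq : ¬ (1 + ι) ∣ q)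
    {u w : N} (hu : IsIntegral GaussianInt u)
    (hy : IsIntegral GaussianInt (w / algebraMap GaussianInt N q))
    (hz : IsIntegral GaussianInt ((u + w) / algebraMap GaussianInt N p)) :
    IsIntegral GaussianInt
      ((algebraMap GaussianInt N (absSq q) * u + w) / algebraMap GaussianInt N (p * q)) := by
  have hp0 : p ≠ 0 := by rintro rfl; exact absurd (zero_dvd_iff.1 hp) (by decide)
  have hq0 : q ≠ 0 := by rintro rfl; exact hq (dvd_zero _)
  have hp' := algebraMap_ne_zero (N := N) hp0
  have hq' := algebraMap_ne_zero (N := N) hq0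
  -- Multiplying by p leaves q̄u + w/q, integral by `hy`. Multiplying by q and writing |q|² = 1 + pt
  -- leaves tu + (u + w)/p, integral by `hz`.
  refine mem_of_isCoprime_smul (integralClosure GaussianInt N).toSubmodule
    ((isCoprime_four hq).of_isCoprime_of_dvd_left hp) ?_ ?_
  · have e : p • ((algebraMap GaussianInt N (absSq q) * u + w) / algebraMap GaussianInt N (p * q)) =
        algebraMap GaussianInt N (star q) * u + w / algebraMap GaussianInt N q := by
      rw [Algebra.smul_def, absSq, map_mul, map_mul]
      field_simp
    rw [e]
    exact (isIntegral_algebraMap.mul hu).add hy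
  · obtain ⟨t, ht⟩ := hp.trans (four_dvd_absSq_sub_one hq)
    have ht' : algebraMap GaussianInt N (absSq q) =
        1 + algebraMap GaussianInt N p * algebraMap GaussianInt N t := by
      rw [← map_mul, ← ht, map_sub, map_one]; ring
    have e : q • ((algebraMap GaussianInt N (absSq q) * u + w) / algebraMap GaussianInt N (p * q)) =
        algebraMap GaussianInt N t * u + (u + w) / algebraMap GaussianInt N p := by
      rw [Algebra.smul_def, map_mul, ht']
      field_simp
      ring
    rw [e]
    exact (isIntegral_algebraMap.mul hu).add hz

end Lift

/-- The common shape of the families `basisOne` and `basisTwo`. -/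
def triangularFamily {N : Type*} [Field N] [Algebra GaussianInt N]
    (g h : GaussianInt) (r : Fin 2 → GaussianInt) (s : Fin 3 → GaussianInt) (α : N) : Fin 4 → N :=
  let c := algebraMap GaussianInt N
  ![1,
    (1 + α) / c (1 + ι),
    (c (absSq (g * h)) * (c (r 0) + c (r 1) * α) + α ^ 2) / c (2 * (1 + ι) * g * h),
    (c (absSq (g * h ^ 2)) * (c (s 0) + c (s 1) * α + c (s 2) * α ^ 2) + α ^ 3) /
      c (4 * g * h ^ 2)]

/-! ### Integrality of the two families -/

section Family

variable {N : Type*} [Field N] [Algebra GaussianInt N] (g h : GaussianInt) (α : N)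

theorem basisOne_eq : basisOne g h α = triangularFamily g h ![ι, 1 + ι] ![1, 1, 1] α := by
  simp [basisOne, triangularFamily]

theorem basisTwo_eq : basisTwo g h α = triangularFamily g h ![-ι, 1 + ι] ![2 - ι, 1, ι] α := by
  simp [basisTwo, triangularFamily]

variable {g h α} {f m : GaussianInt} [FaithfulSMul GaussianInt N]

theorem isIntegral_sq_div (hgh : g * h ≠ 0) (hm : m = f * g ^ 2 * h ^ 3)
    (hα : α ^ 4 = algebraMap GaussianInt N m) :
    IsIntegral GaussianInt (α ^ 2 / algebraMap GaussianInt N (g * h)) := by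
  refine IsIntegral.of_pow (n := 2) (by norm_num) ?_
  convert isIntegral_algebraMap (R := GaussianInt) (A := N) (x := f * h) using 1
  have := algebraMap_ne_zero (N := N) hgh
  rw [div_pow, div_eq_iff (pow_ne_zero _ this), ← pow_mul, hα, hm, ← map_pow, ← map_mul]
  congr 1; ring

theorem isIntegral_cube_div (hgh : g * h ^ 2 ≠ 0) (hm : m = f * g ^ 2 * h ^ 3)
    (hα : α ^ 4 = algebraMap GaussianInt N m) :
    IsIntegral GaussianInt (α ^ 3 / algebraMap GaussianInt N (g * h ^ 2)) := by
  refine IsIntegral.of_pow (n := 4) (by norm_num) ?_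
  convert isIntegral_algebraMap (R := GaussianInt) (A := N) (x := f ^ 3 * g ^ 2 * h) using 1
  have := algebraMap_ne_zero (N := N) hgh
  rw [div_pow, div_eq_iff (pow_ne_zero _ this), ← pow_mul, mul_comm 3 4, pow_mul, hα, hm,
    ← map_pow, ← map_pow, ← map_mul]
  congr 1; ring

/-- Reduces to the case g = h = 1: `hr` and `hs` are the conditions at 1 + ι, and the only ones that
depend on m beyond its class mod 4. -/
theorem isIntegral_triangularFamily (hm : m = f * g ^ 2 * h ^ 3)
    (hα : α ^ 4 = algebraMap GaussianInt N m) (hm1 : 4 ∣ m - 1)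
    {r : Fin 2 → GaussianInt} {s : Fin 3 → GaussianInt}
    (hr : IsIntegral GaussianInt ((algebraMap GaussianInt N (r 0) +
      algebraMap GaussianInt N (r 1) * α + α ^ 2) / algebraMap GaussianInt N (2 * (1 + ι))))
    (hs : IsIntegral GaussianInt ((algebraMap GaussianInt N (s 0) +
      algebraMap GaussianInt N (s 1) * α + algebraMap GaussianInt N (s 2) * α ^ 2 + α ^ 3) /
        algebraMap GaussianInt N 4)) (j : Fin 4) :
    IsIntegral GaussianInt (triangularFamily g h r s α j) := by
  have hαi := isIntegral_of_pow_four_eq hα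
  have hci : ∀ x, IsIntegral GaussianInt (algebraMap GaussianInt N x) :=
    fun x => isIntegral_algebraMap
  have hodd : ¬ (1 + ι) ∣ m := by
    intro hd
    refine not_one_add_ι_dvd_one ?_
    have h4 : 1 + ι ∣ 4 := one_add_ι_dvd_two.trans ⟨2, by norm_num⟩
    simpa using dvd_sub hd (h4.trans hm1)
  have hgh : ¬ (1 + ι) ∣ g * h := fun hd => hodd (hd.trans ⟨f * g * h ^ 2, by rw [hm]; ring⟩)
  have hghh : ¬ (1 + ι) ∣ g * h ^ 2 := fun hd => hodd (hd.trans ⟨f * g * h, by rw [hm]; ring⟩)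
  have hgh0 : g * h ≠ 0 := by intro h0; exact hgh (h0 ▸ dvd_zero _)
  have hghh0 : g * h ^ 2 ≠ 0 := by intro h0; exact hghh (h0 ▸ dvd_zero _)
  fin_cases j
  · exact isIntegral_one
  · obtain ⟨c, hc⟩ := hm1
    refine isIntegral_one_add_div (α := α) (c := -c) ?_ ?_
    · rw [hα]; congr 1; linear_combination hc
    · have := algebraMap_ne_zero (N := N) one_add_ι_ne_zero
      rw [map_add, map_one] at this
      simp only [triangularFamily, map_add, map_one]
      simp
      field_simp
  · have := isIntegral_absSq_mul_add_div (N := N) (p := 2 * (1 + ι)) ⟨1 - ι, by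
      linear_combination 2 * ι_sq⟩ hgh ((hci (r 0)).add ((hci (r 1)).mul hαi))
      (isIntegral_sq_div hgh0 hm hα) hr
    rw [← mul_assoc] at this
    exact this
  · have := isIntegral_absSq_mul_add_div (N := N) (p := 4) dvd_rfl hghh
      (((hci (s 0)).add ((hci (s 1)).mul hαi)).add ((hci (s 2)).mul (hαi.pow 2)))
      (isIntegral_cube_div hghh0 hm hα) hs
    rw [← mul_assoc] at this
    exact this

theorem isIntegral_basisOne (hm : m = f * g ^ 2 * h ^ 3)
    (hα : α ^ 4 = algebraMap GaussianInt N m) (hm1 : 8 ∣ m - 1) (j : Fin 4) :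
    IsIntegral GaussianInt (basisOne g h α j) := by
  obtain ⟨k, hk⟩ := hm1
  have hα' : α ^ 4 = algebraMap GaussianInt N (1 + 8 * k) := by
    rw [hα]; congr 1; linear_combination hk
  have h2 := two_ne_zero_of_gaussianInt (N := N)
  have hπ := one_add_algebraMap_ι_ne_zero (N := N)
  have key := isIntegral_gamma_one hα' (γ := (algebraMap GaussianInt N ι +
    (1 + algebraMap GaussianInt N ι) * α + α ^ 2) / (2 * (1 + algebraMap GaussianInt N ι)))
    (by field_simp)
  rw [basisOne_eq]
  refine isIntegral_triangularFamily hm hα ⟨2 * k, by rw [hk]; ring⟩ ?_ ?_ j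
  · simpa [map_ofNat] using key.1
  · have h4 : (4 : N) ≠ 0 := by rw [show (4 : N) = 2 * 2 by norm_num]; exact mul_ne_zero h2 h2
    simpa [map_ofNat] using key.2 ((1 + α + α ^ 2 + α ^ 3) / 4) (by field_simp)

theorem isIntegral_basisTwo (hm : m = f * g ^ 2 * h ^ 3)
    (hα : α ^ 4 = algebraMap GaussianInt N m) (hm1 : 8 ∣ m - (1 + 4 * ι)) (j : Fin 4) :
    IsIntegral GaussianInt (basisTwo g h α j) := by
  obtain ⟨k, hk⟩ := hm1
  have hα' : α ^ 4 = algebraMap GaussianInt N (1 + 4 * ι + 8 * k) := by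
    rw [hα]; congr 1; linear_combination hk
  have h2 := two_ne_zero_of_gaussianInt (N := N)
  have hπ := one_add_algebraMap_ι_ne_zero (N := N)
  have key := isIntegral_gamma_two hα' (γ := (-algebraMap GaussianInt N ι +
    (1 + algebraMap GaussianInt N ι) * α + α ^ 2) / (2 * (1 + algebraMap GaussianInt N ι)))
    (by field_simp)
  rw [basisTwo_eq]
  refine isIntegral_triangularFamily hm hα ⟨2 * k + ι, by linear_combination hk⟩ ?_ ?_ j
  · simpa [map_ofNat] using key.1
  · have h4 : (4 : N) ≠ 0 := by rw [show (4 : N) = 2 * 2 by norm_num]; exact mul_ne_zero h2 h2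
    simpa [map_ofNat] using key.2 ((2 - algebraMap GaussianInt N ι + α +
      algebraMap GaussianInt N ι * α ^ 2 + α ^ 3) / 4) (by field_simp)

end Family

/-! ### Discriminant of the families -/

section Discriminant

variable {K N : Type*} [Field K] [Algebra GaussianInt K] [IsFractionRing GaussianInt K]
    [Field N] [Algebra K N] [Algebra GaussianInt N] [IsScalarTower GaussianInt K N]
    {f g h m : GaussianInt} {α : N}

theorem discr_triangularFamily (hg : g ≠ 0) (hh : h ≠ 0) (hm : m = f * g ^ 2 * h ^ 3)
    (hα : α ^ 4 = algebraMap GaussianInt N m)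
    (hN : IntermediateField.adjoin K {α} = ⊤) (hdeg : Module.finrank K N = 4)
    (r : Fin 2 → GaussianInt) (s : Fin 3 → GaussianInt) :
    Algebra.discr K (triangularFamily g h r s α) =
      algebraMap GaussianInt K (f ^ 3 * g ^ 2 * h ^ 3) := by
  have : CharZero K := charZero_of_injective_algebraMap (IsFractionRing.injective GaussianInt K)
  have hπ := one_add_algebraMap_ι_ne_zero (N := K)
  have hI := algebraMap_ι_sq (N := K)
  let c := algebraMap GaussianInt K
  have hc : ∀ x, algebraMap K N (c x) = algebraMap GaussianInt N x := fun x =>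
    (IsScalarTower.algebraMap_apply GaussianInt K N x).symm
  have hg' := algebraMap_ne_zero (N := K) hg
  have hh' := algebraMap_ne_zero (N := K) hh
  have hfam : triangularFamily g h r s α =
      ![1, algebraMap K N (1 / c (1 + ι)) + algebraMap K N (1 / c (1 + ι)) * α,
        algebraMap K N (c (absSq (g * h)) * c (r 0) / c (2 * (1 + ι) * g * h)) +
          algebraMap K N (c (absSq (g * h)) * c (r 1) / c (2 * (1 + ι) * g * h)) * α +
          algebraMap K N (1 / c (2 * (1 + ι) * g * h)) * α ^ 2,
        algebraMap K N (c (absSq (g * h ^ 2)) * c (s 0) / c (4 * g * h ^ 2)) +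
          algebraMap K N (c (absSq (g * h ^ 2)) * c (s 1) / c (4 * g * h ^ 2)) * α +
          algebraMap K N (c (absSq (g * h ^ 2)) * c (s 2) / c (4 * g * h ^ 2)) * α ^ 2 +
          algebraMap K N (1 / c (4 * g * h ^ 2)) * α ^ 3] := by
    simp only [triangularFamily, map_div₀, map_mul (algebraMap K N), hc, map_one (algebraMap K N)]
    congr 1
    funext j
    generalize algebraMap GaussianInt N (2 * (1 + ι) * g * h) = d₂
    generalize algebraMap GaussianInt N (4 * g * h ^ 2) = d₃
    generalize algebraMap GaussianInt N (1 + ι) = d₁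
    fin_cases j
    · change (1 + α) / d₁ = 1 / d₁ + 1 / d₁ * α
      ring
    · change (_ : N) / _ = _ / _ + _ / _ * _ + _ / _ * _
      ring
    · change (_ : N) / _ = _ / _ + _ / _ * _ + _ / _ * _ + _ / _ * _
      ring
  -- The diagonal product is 1/(8(1 + ι)²g²h³), whose square is -1/(256g⁴h⁶); multiplied by -256m³
  -- it gives m³/(g⁴h⁶).
  rw [hfam, discr_lowerTriangular (a := c m) (by rw [hα, hc]) hN hdeg hI, hm]
  simp only [c, map_mul, map_add, map_pow, map_one, map_ofNat]
  generalize algebraMap GaussianInt K ι = I at *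
  field_simp
  have e4 : (1 + I) ^ 4 = -4 := by linear_combination (I ^ 2 + 4 * I + 5) * hI
  rw [e4]
  ring

end Discriminant

/-! ### Conjugates and denominators of integers -/

section Conjugates

variable {F L : Type*} [Field F] [Field L] [Algebra F L] {a : F} {α : L}

theorem algebraMap_trace_eq_sum (hα : α ^ 4 = algebraMap F L a)
    (hL : IntermediateField.adjoin F {α} = ⊤) (hdeg : Module.finrank F L = 4)
    [NeZero (2 : F)] {i : F} (hi : i ^ 2 = -1) {σ : L ≃ₐ[F] L}
    (hσ : σ α = algebraMap F L i * α) (x : L) :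
    algebraMap F L (Algebra.trace F L x) = x + σ x + σ (σ x) + σ (σ (σ x)) := by
  obtain ⟨a, rfl⟩ := exists_coords hL hdeg x
  rw [trace_coords hα hL hdeg hi]
  have hI : algebraMap F L i ^ 2 = -1 := by rw [← map_pow, hi, map_neg, map_one]
  simp only [map_add, map_mul, map_pow, AlgEquiv.commutes, hσ, map_ofNat]
  generalize algebraMap F L i = I at *
  grind

end Conjugates

theorem isIntegral_of_eq {R B : Type*} [CommRing R] [Ring B] [Algebra R B] {x y : B}
    (hx : IsIntegral R x) (hy : y = x) : IsIntegral R y := hy ▸ hx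

theorem isIntegral_algEquiv {R F L : Type*} [CommRing R] [Field F] [Field L] [Algebra F L]
    [Algebra R F] [Algebra R L] [IsScalarTower R F L] (σ : L ≃ₐ[F] L) {x : L}
    (hx : IsIntegral R x) : IsIntegral R (σ x) :=
  hx.map (σ.toAlgHom.restrictScalars R)

variable {K N : Type*} [Field K] [Algebra GaussianInt K] [IsFractionRing GaussianInt K]
    [Field N] [Algebra K N] [Algebra GaussianInt N] [IsScalarTower GaussianInt K N]
    {f g h m : GaussianInt} {α : N}

theorem charZero_of_isFractionRing (K : Type*) [Field K] [Algebra GaussianInt K]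
    [IsFractionRing GaussianInt K] : CharZero K :=
  charZero_of_injective_algebraMap (IsFractionRing.injective GaussianInt K)

/-- For x = Σ aⱼαʲ, the sums Σₖ ι⁻ʲᵏ σᵏ(x) equal 4aⱼαʲ and are integral. A suitable power of each
lies in K, and power-freeness of the parts of m bounds the denominator of aⱼ. -/
theorem exists_four_mul_eq (hf : Squarefree f) (hg : Squarefree g) (hh : Squarefree h)
    (hfg : IsCoprime f g) (hfh : IsCoprime f h) (hgh : IsCoprime g h)
    (hm : m = f * g ^ 2 * h ^ 3) (hα : α ^ 4 = algebraMap GaussianInt N m)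
    (hN : IntermediateField.adjoin K {α} = ⊤) (hdeg : Module.finrank K N = 4)
    {x : N} (hx : IsIntegral GaussianInt x) :
    ∃ p : Fin 4 → GaussianInt, 4 * x = algebraMap GaussianInt N (p 0) +
      algebraMap GaussianInt N (p 1) * α +
      algebraMap GaussianInt N (p 2) * (α ^ 2 / algebraMap GaussianInt N (g * h)) +
      algebraMap GaussianInt N (p 3) * (α ^ 3 / algebraMap GaussianInt N (g * h ^ 2)) := by
  have : FaithfulSMul GaussianInt N := FaithfulSMul.trans GaussianInt K N
  let c := algebraMap GaussianInt K
  have hc : ∀ x, algebraMap K N (c x) = algebraMap GaussianInt N x := fun x =>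
    (IsScalarTower.algebraMap_apply GaussianInt K N x).symm
  have hi : c ι ^ 2 = -1 := algebraMap_ι_sq
  have hαK : α ^ 4 = algebraMap K N (c m) := by rw [hα, hc]
  obtain ⟨σ, hσ⟩ := exists_algEquiv_apply_eq hαK hN hdeg hi
  obtain ⟨a, ha⟩ := exists_coords hN hdeg x
  have hI : algebraMap K N (c ι) ^ 2 = -1 := by rw [← map_pow, hi, map_neg, map_one]
  have hIi : IsIntegral GaussianInt (algebraMap K N (c ι)) := by
    rw [hc]; exact isIntegral_algebraMap
  have i1 := isIntegral_algEquiv σ hx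
  have i2 := isIntegral_algEquiv σ i1
  have i3 := isIntegral_algEquiv σ i2
  have e1 : σ x = algebraMap K N (a 0) + algebraMap K N (a 1) * (algebraMap K N (c ι) * α) -
      algebraMap K N (a 2) * α ^ 2 - algebraMap K N (a 3) * (algebraMap K N (c ι) * α ^ 3) := by
    rw [ha]
    simp only [map_add, map_mul, map_pow, AlgEquiv.commutes, hσ]
    linear_combination (algebraMap K N (a 2) * α ^ 2 +
      algebraMap K N (a 3) * algebraMap K N (c ι) * α ^ 3) * hI
  have e2 : σ (σ x) = algebraMap K N (a 0) - algebraMap K N (a 1) * α +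
      algebraMap K N (a 2) * α ^ 2 - algebraMap K N (a 3) * α ^ 3 := by
    rw [e1]
    simp only [map_add, map_sub, map_mul, map_pow, AlgEquiv.commutes, hσ]
    generalize algebraMap K N (c ι) = I at *
    grind
  have e3 : σ (σ (σ x)) = algebraMap K N (a 0) -
      algebraMap K N (a 1) * (algebraMap K N (c ι) * α) -
      algebraMap K N (a 2) * α ^ 2 + algebraMap K N (a 3) * (algebraMap K N (c ι) * α ^ 3) := by
    rw [e2]
    simp only [map_add, map_sub, map_mul, map_pow, AlgEquiv.commutes, hσ]
    generalize algebraMap K N (c ι) = I at *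
    grind
  have j0 : IsIntegral GaussianInt (algebraMap K N (4 * a 0)) := by
    refine isIntegral_of_eq (((hx.add i1).add i2).add i3) ?_
    rw [e3, e2, e1, ha, map_mul, map_ofNat]
    ring
  have j1 : IsIntegral GaussianInt (algebraMap K N (4 * a 1) * α) := by
    refine isIntegral_of_eq (((hx.sub (hIi.mul i1)).sub i2).add (hIi.mul i3)) ?_
    rw [e3, e2, e1, ha, map_mul, map_ofNat]
    generalize algebraMap K N (c ι) = I at *
    grind
  have j2 : IsIntegral GaussianInt (algebraMap K N (4 * a 2) * α ^ 2) := by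
    refine isIntegral_of_eq (((hx.sub i1).add i2).sub i3) ?_
    rw [e3, e2, e1, ha, map_mul, map_ofNat]
    ring
  have j3 : IsIntegral GaussianInt (algebraMap K N (4 * a 3) * α ^ 3) := by
    refine isIntegral_of_eq (((hx.add (hIi.mul i1)).sub i2).sub (hIi.mul i3)) ?_
    rw [e3, e2, e1, ha, map_mul, map_ofNat]
    generalize algebraMap K N (c ι) = I at *
    grind
  have down : ∀ y : K, IsIntegral GaussianInt (algebraMap K N y) → IsIntegral GaussianInt y :=
    fun y => (isIntegral_algebraMap_iff (algebraMap K N).injective).1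
  have hg0 := algebraMap_ne_zero (N := N) hg.ne_zero
  have hh0 := algebraMap_ne_zero (N := N) hh.ne_zero
  obtain ⟨p0, hp0⟩ := IsIntegrallyClosed.isIntegral_iff.1 (down _ j0)
  obtain ⟨p1, hp1⟩ : ∃ z, c z = 4 * a 1 := by
    refine mem_range_of_pow_mul (n := 4) (s := m) (fun p hp => ?_) (down _ ?_)
    · rw [hm]; exact not_prime_pow_four_dvd hf hg hh hfg hfh hgh hp
    · rw [map_mul, map_pow, ← hαK, ← mul_pow]
      exact j1.pow 4
  -- Here m = fh·(gh)², so (4a₂gh)²·fh = (4a₂α²)² is integral with fh squarefree.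
  obtain ⟨p2, hp2⟩ : ∃ z, c z = 4 * a 2 * c (g * h) := by
    refine mem_range_of_pow_mul (n := 2) (s := f * h) (fun p hp hd => ?_) (down _ ?_)
    · exact hp.not_isUnit (squarefree_mul_iff.2 ⟨hfh.isRelPrime, hf, hh⟩ p (by rwa [← sq]))
    · refine isIntegral_of_eq (j2.pow 2) ?_
      have : c (f * h) * c (g * h) ^ 2 = c m := by
        rw [← map_pow, ← map_mul, hm]; congr 1; ring
      rw [mul_pow (4 * a 2), mul_assoc, mul_comm (c _ ^ 2), this, map_mul, ← hαK, map_pow]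
      ring
  -- Here m³ = hg²f³·(gh²)⁴, and hg²f³ is free of fourth powers by the same lemma with f and h
  -- exchanged.
  obtain ⟨p3, hp3⟩ : ∃ z, c z = 4 * a 3 * c (g * h ^ 2) := by
    refine mem_range_of_pow_mul (n := 4) (s := h * g ^ 2 * f ^ 3) (fun p hp => ?_) (down _ ?_)
    · exact not_prime_pow_four_dvd hh hg hf hgh.symm hfh.symm hfg.symm hp
    · refine isIntegral_of_eq (j3.pow 4) ?_
      have : c (h * g ^ 2 * f ^ 3) * c (g * h ^ 2) ^ 4 = c m ^ 3 := by
        rw [← map_pow, ← map_mul, ← map_pow, hm]; congr 1; ring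
      rw [mul_pow (4 * a 3), mul_assoc, mul_comm (c _ ^ 4), this, map_mul,
        map_pow _ (c m), ← hαK, map_pow]
      ring
  refine ⟨![p0, p1, p2, p3], ?_⟩
  simp only [Matrix.cons_val]
  rw [← hc p0, ← hc p1, ← hc p2, ← hc p3, hp1, hp2, hp3]
  erw [hp0]
  rw [map_mul _ _ (c (g * h)), map_mul _ _ (c (g * h ^ 2)), hc, hc]
  simp only [map_mul, map_pow, map_ofNat]
  rw [ha]
  field_simp

theorem four_smul_mem_span (hf : Squarefree f) (hg : Squarefree g) (hh : Squarefree h)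
    (hfg : IsCoprime f g) (hfh : IsCoprime f h) (hgh : IsCoprime g h)
    (hm : m = f * g ^ 2 * h ^ 3) (hα : α ^ 4 = algebraMap GaussianInt N m)
    (hN : IntermediateField.adjoin K {α} = ⊤) (hdeg : Module.finrank K N = 4)
    (r : Fin 2 → GaussianInt) (s : Fin 3 → GaussianInt)
    {x : N} (hx : IsIntegral GaussianInt x) :
    (4 : GaussianInt) • x ∈
      Submodule.span GaussianInt (Set.range (triangularFamily g h r s α)) := by
  have : FaithfulSMul GaussianInt N := FaithfulSMul.trans GaussianInt K N
  set S := Submodule.span GaussianInt (Set.range (triangularFamily g h r s α)) with hS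
  have hv : ∀ j, triangularFamily g h r s α j ∈ S := fun j => Submodule.subset_span ⟨j, rfl⟩
  have hπ := algebraMap_ne_zero (N := N) one_add_ι_ne_zero
  have hg0 := algebraMap_ne_zero (N := N) hg.ne_zero
  have hh0 := algebraMap_ne_zero (N := N) hh.ne_zero
  have h2 := two_ne_zero_of_gaussianInt (N := N)
  have h4 : (4 : N) ≠ 0 := by rw [show (4 : N) = 2 * 2 by norm_num]; exact mul_ne_zero h2 h2
  have m0 : (1 : N) ∈ S := hv 0
  have m1 : α ∈ S := by
    convert S.sub_mem (S.smul_mem (1 + ι) (hv 1)) m0 using 1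
    simp only [triangularFamily, Matrix.cons_val, Algebra.smul_def]
    field_simp
    ring
  -- Since |gh|²/(gh) is the conjugate of gh, the lower terms to be subtracted have coefficients in
  -- ℤ[i]; likewise for α³ with gh².
  have m2 : α ^ 2 / algebraMap GaussianInt N (g * h) ∈ S := by
    convert S.sub_mem (S.smul_mem (2 * (1 + ι)) (hv 2)) (S.smul_mem (star (g * h))
      (S.add_mem (S.smul_mem (r 0) m0) (S.smul_mem (r 1) m1))) using 1
    simp only [triangularFamily, Matrix.cons_val, Algebra.smul_def, absSq, map_mul, map_ofNat]
    field_simp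
    ring
  have m2' : α ^ 2 ∈ S := by
    convert S.smul_mem (g * h) m2 using 1
    rw [Algebra.smul_def, map_mul]
    field_simp
  have m3 : α ^ 3 / algebraMap GaussianInt N (g * h ^ 2) ∈ S := by
    convert S.sub_mem (S.smul_mem 4 (hv 3)) (S.smul_mem (star (g * h ^ 2))
      (S.add_mem (S.add_mem (S.smul_mem (s 0) m0) (S.smul_mem (s 1) m1))
        (S.smul_mem (s 2) m2'))) using 1
    simp only [triangularFamily, Matrix.cons_val, Algebra.smul_def, absSq, map_mul, map_pow,
      map_ofNat]
    field_simp
    ring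
  obtain ⟨p, hp⟩ := exists_four_mul_eq hf hg hh hfg hfh hgh hm hα hN hdeg hx
  rw [Algebra.smul_def, map_ofNat, hp]
  simp only [← Algebra.smul_def]
  refine S.add_mem (S.add_mem (S.add_mem ?_ (S.smul_mem _ m1)) (S.smul_mem _ m2)) (S.smul_mem _ m3)
  simpa [Algebra.smul_def] using S.smul_mem (p 0) m0

/-! ### Integral bases, relative discriminant and odd discriminants -/

section IntegralBasis

variable {K N : Type*} [Field K] [Algebra GaussianInt K] [IsFractionRing GaussianInt K]
    [Field N] [Algebra K N] [Algebra GaussianInt N] [IsScalarTower GaussianInt K N]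

theorem isIntegralBasis_of_mem_span {v : Fin 4 → N} (hv : ∀ j, IsIntegral GaussianInt (v j))
    (hli : LinearIndependent K v)
    (hspan : ∀ x : N, IsIntegral GaussianInt x → x ∈ Submodule.span GaussianInt (Set.range v)) :
    IsIntegralBasis v := by
  let w : Fin 4 → ringOfInt N := fun j => ⟨v j, hv j⟩
  have hliA : LinearIndependent GaussianInt v := hli.restrict_scalars' GaussianInt
  have hw : LinearIndependent GaussianInt w :=
    LinearIndependent.of_comp (ringOfInt N).val.toLinearMap hliA
  refine ⟨Module.Basis.mk hw fun x _ => ?_, fun j => by rw [Module.Basis.mk_apply]⟩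
  obtain ⟨c, hc⟩ := (Submodule.mem_span_range_iff_exists_fun _).1 (hspan x x.2)
  refine (Submodule.mem_span_range_iff_exists_fun _).2 ⟨c, Subtype.ext ?_⟩
  rw [← hc]
  simp [w, Algebra.smul_def]

/-- Any basis of integers is the image of v under a matrix over ℤ[i], so its discriminant is d times
the square of a determinant; v itself attains d. -/
theorem relDiscr_eq_span {v : Fin 4 → N} (hdeg : Module.finrank K N = 4)
    (hv : ∀ j, IsIntegral GaussianInt (v j)) (hli : LinearIndependent K v)
    (hspan : ∀ x : N, IsIntegral GaussianInt x → x ∈ Submodule.span GaussianInt (Set.range v))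
    {d : GaussianInt} (hd : Algebra.discr K v = algebraMap GaussianInt K d) :
    relDiscr N K = Ideal.span {d} := by
  apply le_antisymm
  · refine Ideal.span_le.2 ?_
    rintro e ⟨b, hb, he⟩
    let b' := b.reindex (finCongr hdeg)
    have hb' : ∀ j, IsIntegral GaussianInt (b' j) := fun j => by
      rw [Module.Basis.reindex_apply]; exact hb _
    choose A hA using fun j => (Submodule.mem_span_range_iff_exists_fun _).1 (hspan _ (hb' j))
    have hmat : (b' : Fin 4 → N) =
        (((Matrix.of A).map (algebraMap GaussianInt K)).map (algebraMap K N)).mulVec v := by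
      ext j
      rw [← hA j]
      simp [Matrix.mulVec, dotProduct, Algebra.smul_def, ← IsScalarTower.algebraMap_apply]
    have hdiscr : Algebra.discr K b = Algebra.discr K b' := by
      rw [Module.Basis.coe_reindex, Algebra.discr_reindex]
    rw [hdiscr, hmat, Algebra.discr_of_matrix_mulVec, hd, ← RingHom.mapMatrix_apply,
      ← RingHom.map_det, ← map_pow, ← map_mul] at he
    exact Ideal.mem_span_singleton.2 ⟨_, (IsFractionRing.injective GaussianInt K he).trans
      (mul_comm _ _)⟩
  · refine Ideal.span_le.2 (Set.singleton_subset_iff.2 (Ideal.subset_span ?_))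
    let b := basisOfLinearIndependentOfCardEqFinrank hli (by simp [hdeg])
    refine ⟨b.reindex (finCongr hdeg.symm), fun j => ?_, ?_⟩
    · rw [Module.Basis.reindex_apply, coe_basisOfLinearIndependentOfCardEqFinrank]
      exact hv _
    · rw [Module.Basis.coe_reindex, Algebra.discr_reindex,
        coe_basisOfLinearIndependentOfCardEqFinrank, hd]

theorem linearIndependent_of_discr_eq {K N : Type*} [Field K] [Algebra GaussianInt K]
    [IsFractionRing GaussianInt K] [Field N] [Algebra K N] {v : Fin 4 → N} {d : GaussianInt}
    (hd0 : d ≠ 0) (hd : Algebra.discr K v = algebraMap GaussianInt K d) :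
    LinearIndependent K v := by
  by_contra hli
  rw [Algebra.discr_zero_of_not_linearIndependent K hli] at hd
  exact algebraMap_ne_zero hd0 hd.symm

theorem smul_mem_span_of_isIntegral_trace {v : Fin 4 → N} (hdeg : Module.finrank K N = 4)
    (hv : ∀ j, IsIntegral GaussianInt (v j)) {d : GaussianInt} (hd0 : d ≠ 0)
    (hd : Algebra.discr K v = algebraMap GaussianInt K d) {x : N}
    (hx : ∀ j, IsIntegral GaussianInt (Algebra.trace K N (x * v j))) :
    d • x ∈ Submodule.span GaussianInt (Set.range v) := by
  have : FiniteDimensional K N := Module.finite_of_finrank_pos (by omega)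
  let b := basisOfLinearIndependentOfCardEqFinrank (linearIndependent_of_discr_eq hd0 hd)
    (by simp [hdeg])
  have hb : (b : Fin 4 → N) = v := coe_basisOfLinearIndependentOfCardEqFinrank _ _
  have := discr_smul_mem_span (R := GaussianInt) b (by simpa [hb] using hv) (d := d)
    (by rw [hb, hd]) (x := x) (by simpa [hb] using hx)
  rwa [hb] at this

/-- The denominators of x divide both 4 (by `h4`) and d (by Cramer's rule), which are coprime. -/
theorem mem_span_of_isIntegral {v : Fin 4 → N} (hdeg : Module.finrank K N = 4)
    (hv : ∀ j, IsIntegral GaussianInt (v j)) {d : GaussianInt} (hd2 : ¬ (1 + ι) ∣ d)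
    (hd : Algebra.discr K v = algebraMap GaussianInt K d)
    (h4 : ∀ x : N, IsIntegral GaussianInt x →
      (4 : GaussianInt) • x ∈ Submodule.span GaussianInt (Set.range v))
    {x : N} (hx : IsIntegral GaussianInt x) : x ∈ Submodule.span GaussianInt (Set.range v) := by
  have : FiniteDimensional K N := Module.finite_of_finrank_pos (by omega)
  have hd0 : d ≠ 0 := by rintro rfl; exact hd2 (dvd_zero _)
  exact mem_of_isCoprime_smul _ (isCoprime_four hd2) (h4 x hx)
    (smul_mem_span_of_isIntegral_trace hdeg hv hd0 hd fun j =>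
      Algebra.isIntegral_trace (hx.mul (hv j)))

/-- If `1 + ι` divides `x ^ 2` in the ring of integers, then it divides the trace of `x`. -/
theorem isIntegral_trace_div {m : GaussianInt} {α : N} (hα : α ^ 4 = algebraMap GaussianInt N m)
    (hN : IntermediateField.adjoin K {α} = ⊤) (hdeg : Module.finrank K N = 4) {x : N}
    (hx : IsIntegral GaussianInt x)
    (hx2 : IsIntegral GaussianInt (x ^ 2 / algebraMap GaussianInt N (1 + ι))) :
    IsIntegral GaussianInt (Algebra.trace K N (x / algebraMap GaussianInt N (1 + ι))) := by
  have : FaithfulSMul GaussianInt N := FaithfulSMul.trans GaussianInt K N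
  have : CharZero K := charZero_of_isFractionRing K
  have : FiniteDimensional K N := Module.finite_of_finrank_pos (by omega)
  have hc : ∀ x, algebraMap K N (algebraMap GaussianInt K x) = algebraMap GaussianInt N x :=
    fun x => (IsScalarTower.algebraMap_apply GaussianInt K N x).symm
  have hαK : α ^ 4 = algebraMap K N (algebraMap GaussianInt K m) := by rw [hα, hc]
  have hπN := algebraMap_ne_zero (N := N) one_add_ι_ne_zero
  have hπK := algebraMap_ne_zero (N := K) one_add_ι_ne_zero
  obtain ⟨σ, hσ⟩ := exists_algEquiv_apply_eq hαK hN hdeg algebraMap_ι_sq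
  have htr := algebraMap_trace_eq_sum hαK hN hdeg algebraMap_ι_sq hσ
  have i1 := isIntegral_algEquiv σ hx
  have i2 := isIntegral_algEquiv σ i1
  have i3 := isIntegral_algEquiv σ i2
  -- With t = Tr x and e the second elementary symmetric function of the conjugates, t² = Tr(x²) +
  -- 2e. Both terms are divisible by 1 + ι, hence so is t.
  obtain ⟨t, ht⟩ := IsIntegrallyClosed.isIntegral_iff.1 (Algebra.isIntegral_trace (L := K) hx)
  obtain ⟨u, hu⟩ := IsIntegrallyClosed.isIntegral_iff.1 (Algebra.isIntegral_trace (L := K) hx2)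
  have he : IsIntegral GaussianInt (algebraMap K N
      ((algebraMap GaussianInt K (t ^ 2 - (1 + ι) * u)) / 2)) := by
    refine isIntegral_of_eq (((((((hx.mul i1).add (hx.mul i2)).add (hx.mul i3)).add
      (i1.mul i2)).add (i1.mul i3)).add (i2.mul i3))) ?_
    have hx2' := htr (x ^ 2)
    have hsq : Algebra.trace K N (x ^ 2) = algebraMap GaussianInt K ((1 + ι) * u) := by
      rw [map_mul, hu, ← smul_eq_mul, ← map_smul, Algebra.smul_def, hc, mul_div_cancel₀ _ hπN]
    have : (2 : N) ≠ 0 := two_ne_zero_of_gaussianInt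
    rw [map_div₀, map_ofNat, map_sub, map_sub, ← hsq, hx2', map_pow, map_pow, ht, htr x,
      div_eq_iff this]
    simp only [map_pow]
    ring
  obtain ⟨e, he⟩ := IsIntegrallyClosed.isIntegral_iff.1
    ((isIntegral_algebraMap_iff (algebraMap K N).injective).1 he)
  have h2 : t ^ 2 - (1 + ι) * u = 2 * e := by
    apply IsFractionRing.injective GaussianInt K
    rw [map_mul, he, map_ofNat]
    field_simp
  obtain ⟨w, hw⟩ : 1 + ι ∣ t := by
    refine prime_one_add_ι.dvd_of_dvd_pow (n := 2) ⟨u + (1 - ι) * e, ?_⟩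
    linear_combination h2 + e * ι_sq
  refine isIntegral_of_eq (isIntegral_algebraMap (x := w)) ?_
  have hsm : x / algebraMap GaussianInt N (1 + ι) =
      (algebraMap GaussianInt K (1 + ι))⁻¹ • x := by
    rw [Algebra.smul_def, map_inv₀, hc]
    field_simp
  rw [hsm, map_smul, ← ht, hw, map_mul, smul_eq_mul]
  field_simp

/-- If x is nilpotent mod 1 + ι, so is each x·vⱼ, hence all traces of x·vⱼ/(1 + ι) are integral. By
Cramer's rule d·x/(1 + ι) is integral, and d is odd. -/
theorem isIntegral_div_of_isIntegral_sq_div {m : GaussianInt} {α : N}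
    (hα : α ^ 4 = algebraMap GaussianInt N m)
    (hN : IntermediateField.adjoin K {α} = ⊤) (hdeg : Module.finrank K N = 4)
    {v : Fin 4 → N} (hv : ∀ j, IsIntegral GaussianInt (v j)) {d : GaussianInt}
    (hd2 : ¬ (1 + ι) ∣ d) (hd : Algebra.discr K v = algebraMap GaussianInt K d) {x : N}
    (hx : IsIntegral GaussianInt x)
    (hx2 : IsIntegral GaussianInt (x ^ 2 / algebraMap GaussianInt N (1 + ι))) :
    IsIntegral GaussianInt (x / algebraMap GaussianInt N (1 + ι)) := by
  have : FaithfulSMul GaussianInt N := FaithfulSMul.trans GaussianInt K N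
  have hπN := algebraMap_ne_zero (N := N) one_add_ι_ne_zero
  have hd0 : d ≠ 0 := by rintro rfl; exact hd2 (dvd_zero _)
  have hle : Submodule.span GaussianInt (Set.range v) ≤
      Subalgebra.toSubmodule (integralClosure GaussianInt N) :=
    Submodule.span_le.2 (by rintro _ ⟨j, rfl⟩; exact hv j)
  refine mem_of_isCoprime_smul (Subalgebra.toSubmodule (integralClosure GaussianInt N))
    (isCoprime_one_add_ι hd2) ?_
    (hle (smul_mem_span_of_isIntegral_trace hdeg hv hd0 hd fun j => ?_))
  · rw [Algebra.smul_def, mul_div_cancel₀ _ hπN]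
    exact hx
  · rw [div_mul_eq_mul_div]
    refine isIntegral_trace_div hα hN hdeg (hx.mul (hv j)) ?_
    rw [mul_pow, mul_div_right_comm]
    exact hx2.mul ((hv j).pow 2)

end IntegralBasis

/-! ### Unramified primes and radical ideals -/

section Ramification

variable {K N : Type*} [Field K] [Algebra GaussianInt K] [IsFractionRing GaussianInt K]
    [Field N] [Algebra K N] [Algebra GaussianInt N] [IsScalarTower GaussianInt K N]

variable (K) in
/-- A prime element is unramified if and only if it generates a radical ideal in the ring of
integers. -/
theorem isUnramifiedOver_span_iff [FiniteDimensional K N] {p : GaussianInt} (hp : Prime p) :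
    IsUnramifiedOver N (Ideal.span {p}) ↔ ∀ x : N, IsIntegral GaussianInt x →
      IsIntegral GaussianInt (x ^ 2 / algebraMap GaussianInt N p) →
        IsIntegral GaussianInt (x / algebraMap GaussianInt N p) := by
  have : FaithfulSMul GaussianInt N := FaithfulSMul.trans GaussianInt K N
  have : CharZero K := charZero_of_isFractionRing K
  have : IsDedekindDomain (ringOfInt N) := integralClosure.isDedekindDomain GaussianInt K N
  have hpN := algebraMap_ne_zero (N := N) hp.ne_zero
  set P : ringOfInt N := algebraMap GaussianInt (ringOfInt N) p with hPdef
  have hPcoe : (P : N) = algebraMap GaussianInt N p := rfl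
  have hP0 : P ≠ 0 := fun h0 => hpN (by rw [← hPcoe, h0]; rfl)
  have hmap : (Ideal.span {p}).map (algebraMap GaussianInt (ringOfInt N)) = Ideal.span {P} := by
    rw [Ideal.map_span, Set.image_singleton]
  have hI0 : Ideal.span {P} ≠ ⊥ := by simpa using hP0
  have hdvd : ∀ x : ringOfInt N, P ∣ x ↔
      IsIntegral GaussianInt ((x : N) / algebraMap GaussianInt N p) := by
    intro x
    constructor
    · rintro ⟨y, rfl⟩
      refine isIntegral_of_eq y.2 ?_
      rw [MulMemClass.coe_mul, hPcoe]
      field_simp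
    · intro hx
      refine ⟨⟨_, hx⟩, Subtype.ext ?_⟩
      rw [MulMemClass.coe_mul, hPcoe]
      field_simp
  -- The index at a prime Q above p differs from 1 exactly when the extended ideal lies in Q², that
  -- is, when Q² divides it.
  have hunr : IsUnramifiedOver N (Ideal.span {p}) ↔ Squarefree (Ideal.span {P}) := by
    rw [squarefree_iff_irreducible_sq_not_dvd_of_ne_zero hI0]
    have hpm : (Ideal.span {p}).IsMaximal :=
      ((Ideal.span_singleton_prime hp.ne_zero).2 hp).isMaximal (by simpa using hp.ne_zero)
    constructor
    · intro h Q hQ hQQ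
      have hQp : Q.IsPrime := Ideal.isPrime_of_prime hQ.prime
      have hle : (Ideal.span {p}).map (algebraMap GaussianInt (ringOfInt N)) ≤ Q := by
        rw [hmap]; exact Ideal.le_of_dvd ((Dvd.intro _ rfl).trans hQQ)
      have hover : Q.LiesOver (Ideal.span {p}) :=
        ⟨hpm.eq_of_le (Ideal.IsPrime.under _ Q).ne_top (Ideal.map_le_iff_le_comap.1 hle)⟩
      have h1 := h Q hQp hover
      rw [← Ideal.ramificationIdx'_eq_ramificationIdx' (Ideal.span {p}) Q (by rwa [hmap])] at h1
      refine (Ideal.ramificationIdx'_ne_one_iff hle).2 ?_ h1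
      rw [hmap, sq]; exact Ideal.le_of_dvd hQQ
    · intro h Q hQp hover
      have hle : (Ideal.span {p}).map (algebraMap GaussianInt (ringOfInt N)) ≤ Q :=
        Ideal.map_le_iff_le_comap.2 (Q.over_def (Ideal.span {p})).le
      rw [← Ideal.ramificationIdx'_eq_ramificationIdx' (Ideal.span {p}) Q (by rwa [hmap])]
      by_contra hne
      have hle2 := (Ideal.ramificationIdx'_ne_one_iff hle).1 hne
      have hQ0 : Q ≠ ⊥ := by rintro rfl; rw [hmap] at hle; exact hI0 (le_bot_iff.1 hle)
      refine h Q (Ideal.prime_of_isPrime hQ0 hQp).irreducible ?_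
      rw [hmap, sq] at hle2
      exact Ideal.dvd_iff_le.2 hle2
  have hrad : Squarefree (Ideal.span {P}) ↔ ∀ x : ringOfInt N, P ∣ x ^ 2 → P ∣ x := by
    rw [← isRadical_iff_squarefree_of_ne_zero hI0]
    constructor
    · intro h x hx
      rw [← Ideal.span_singleton_le_span_singleton, ← Ideal.dvd_iff_le] at hx ⊢
      rw [← Ideal.span_singleton_pow] at hx
      exact h 2 _ hx
    · intro h
      -- Testing squares of ideals suffices, and these reduce to elements: x ∈ J gives x² ∈ J².
      rw [isRadical_iff_pow_one_lt 2 (by norm_num)]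
      intro J hJ
      rw [Ideal.dvd_iff_le]
      intro x hx
      refine Ideal.mem_span_singleton.2 (h x ?_)
      exact Ideal.mem_span_singleton.1 (Ideal.le_of_dvd hJ (Ideal.pow_mem_pow hx 2))
  rw [hunr, hrad]
  constructor
  · intro h x hx hx2
    exact (hdvd ⟨x, hx⟩).1 (h ⟨x, hx⟩ ((hdvd _).2 hx2))
  · intro h x hx
    exact (hdvd x).2 (h x x.2 ((hdvd _).1 hx))

end Ramification

/-! ### Necessity of the congruence on m -/

theorem dvd_of_isIntegral_div (K : Type*) {N : Type*} [Field K] [Algebra GaussianInt K]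
    [IsFractionRing GaussianInt K] [Field N] [Algebra K N] [Algebra GaussianInt N]
    [IsScalarTower GaussianInt K N] {a b : GaussianInt} (hb : b ≠ 0)
    (h : IsIntegral GaussianInt (algebraMap GaussianInt N a / algebraMap GaussianInt N b)) :
    b ∣ a := by
  rw [IsScalarTower.algebraMap_apply GaussianInt K N,
    IsScalarTower.algebraMap_apply GaussianInt K N,
    ← map_div₀, isIntegral_algebraMap_iff (algebraMap K N).injective] at h
  obtain ⟨t, ht⟩ := IsIntegrallyClosed.isIntegral_iff.1 h
  have hb' := algebraMap_ne_zero (N := K) hb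
  refine ⟨t, IsFractionRing.injective GaussianInt K ?_⟩
  rw [map_mul, ht]
  field_simp

/-- If `1 + ι` generates a radical ideal in the ring of integers, then the radicand `m` is `1` or
`1 + 4ι` modulo `8`. -/
theorem eight_dvd_of_radical (K : Type*) {N : Type*} [Field K] [Algebra GaussianInt K]
    [IsFractionRing GaussianInt K] [Field N] [Algebra K N] [Algebra GaussianInt N]
    [IsScalarTower GaussianInt K N] {m : GaussianInt} (hm : ¬ (1 + ι) ^ 4 ∣ m) {α : N}
    (hα : α ^ 4 = algebraMap GaussianInt N m)
    (hR : ∀ x : N, IsIntegral GaussianInt x →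
      IsIntegral GaussianInt (x ^ 2 / algebraMap GaussianInt N (1 + ι)) →
        IsIntegral GaussianInt (x / algebraMap GaussianInt N (1 + ι))) :
    8 ∣ m - 1 ∨ 8 ∣ m - (1 + 4 * ι) := by
  have : FaithfulSMul GaussianInt N := FaithfulSMul.trans GaussianInt K N
  have hI := algebraMap_ι_sq (N := N)
  have h2 := two_ne_zero_of_gaussianInt (N := N)
  have h4 : (4 : N) ≠ 0 := by rw [show (4 : N) = 2 * 2 by norm_num]; exact mul_ne_zero h2 h2
  have hπ := one_add_algebraMap_ι_ne_zero (N := N)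
  have hπc : algebraMap GaussianInt N (1 + ι) = 1 + algebraMap GaussianInt N ι := by
    rw [map_add, map_one]
  rw [hπc] at hR
  have hci : ∀ x, IsIntegral GaussianInt (algebraMap GaussianInt N x) :=
    fun x => isIntegral_algebraMap
  have hni : ∀ n : ℕ, IsIntegral GaussianInt (n : N) := fun n =>
    isIntegral_of_eq (hci n) (by rw [map_natCast])
  have i2 : IsIntegral GaussianInt (2 : N) := hni 2
  have i3 : IsIntegral GaussianInt (3 : N) := hni 3
  have hii := hci ι
  have hαi := isIntegral_of_pow_four_eq hα
  have hR4 : ∀ x : N, IsIntegral GaussianInt x →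
      IsIntegral GaussianInt (x ^ 4 / (1 + algebraMap GaussianInt N ι)) →
        IsIntegral GaussianInt (x / (1 + algebraMap GaussianInt N ι)) := by
    intro x hx hx4
    refine hR x hx ?_
    refine hR (x ^ 2) (hx.pow 2) ?_
    rwa [← pow_mul]
  -- If 1 + ι divides m = α⁴, radicality makes it divide α, so (1 + ι)⁴ divides m.
  have hodd : ¬ (1 + ι) ∣ m := by
    rintro ⟨u, hu⟩
    have hdiv := hR4 α hαi (isIntegral_of_eq (hci u) (by
      rw [hα, hu, map_mul, hπc]; field_simp))
    refine hm (dvd_of_isIntegral_div K (N := N) (pow_ne_zero 4 one_add_ι_ne_zero)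
      (isIntegral_of_eq (hdiv.pow 4) ?_))
    rw [div_pow, hα, map_pow, hπc]
  obtain ⟨u, hu⟩ := one_add_ι_dvd_sub_one hodd
  obtain ⟨β, hβ⟩ : ∃ β : N, (1 + algebraMap GaussianInt N ι) * β = 1 + α :=
    ⟨(1 + α) / (1 + algebraMap GaussianInt N ι), by field_simp⟩
  -- Modulo 1 + ι, (1 + α)⁴ ≡ 1 + m ≡ 0, so radicality gives 1 + ι ∣ 1 + α.
  have hβi : IsIntegral GaussianInt β := by
    refine isIntegral_of_eq (hR4 (1 + α) (isIntegral_one.add hαi) (isIntegral_of_eq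
      ((hci u).add ((isIntegral_one.sub hii).mul (((isIntegral_one.add (i2.mul hαi)).add
        (i3.mul (hαi.pow 2))).add (i2.mul (hαi.pow 3))))) ?_)) ?_
    · have hu' := congrArg (algebraMap GaussianInt N) hu
      rw [map_sub, map_mul, map_one, hπc] at hu'
      rw [div_eq_iff hπ]
      linear_combination hα + hu' + (1 + 2 * α + 3 * α ^ 2 + 2 * α ^ 3) * hI
    · rw [← hβ]; field_simp
  -- The quartic for β expresses (1 - m)/4 as a polynomial in β over ℤ[i].
  obtain ⟨c, hc⟩ : 4 ∣ 1 - m := by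
    refine dvd_of_isIntegral_div K (N := N) (by decide) (isIntegral_of_eq
      ((((hβi.pow 4).add ((i2.mul (hii.sub isIntegral_one)).mul (hβi.pow 3))).sub
        ((i3.mul hii).mul (hβi.pow 2))).add ((isIntegral_one.add hii).mul hβi)) ?_)
    rw [map_sub, map_one, ← hα, map_ofNat, div_eq_iff h4]
    generalize algebraMap GaussianInt N ι = I at *
    obtain rfl : α = (1 + I) * β - 1 := by linear_combination -hβ
    have e4 : (1 + I) ^ 4 = -4 := by linear_combination (I ^ 2 + 4 * I + 5) * hI
    have e3 : (1 + I) ^ 3 = 2 * I - 2 := by linear_combination (I + 3) * hI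
    have e2 : (1 + I) ^ 2 = 2 * I := by linear_combination hI
    linear_combination -β ^ 4 * e4 + 4 * β ^ 3 * e3 - 6 * β ^ 2 * e2
  have hq := quartic_of_one_add_div (c := c) (by rw [hα]; congr 1; linear_combination -hc) hβ
  obtain ⟨e, he⟩ : 1 + ι ∣ c + c ^ 2 := by
    by_cases hd : 1 + ι ∣ c
    · exact (hd.mul_right (1 + c)).trans ⟨1, by ring⟩
    · obtain ⟨v, hv⟩ := one_add_ι_dvd_sub_one hd
      obtain ⟨w, hw⟩ := one_add_ι_dvd_two
      exact ⟨c * (v + w), by linear_combination c * (hv + hw)⟩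
  have he' := congrArg (algebraMap GaussianInt N) he
  rw [map_mul, map_add, map_pow, hπc] at he'
  -- Modulo 1 + ι the quartic reads β⁴ + β² + c ≡ 0, so (β² + β + c)² ≡ c² + c ≡ 0.
  have hwi : IsIntegral GaussianInt
      ((β ^ 2 + β + algebraMap GaussianInt N c) / (1 + algebraMap GaussianInt N ι)) := by
    refine hR _ (((hβi.pow 2).add hβi).add (hci c)) (isIntegral_of_eq
      ((((((isIntegral_one.sub hii).mul (i2.sub hii)).mul (hβi.pow 3)).add
        (((i2.add hii).add ((isIntegral_one.sub hii).mul (hci c))).mul (hβi.pow 2))).add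
        ((((isIntegral_one.sub hii).mul (hci c)).sub isIntegral_one).mul hβi)).add (hci e)) ?_)
    rw [div_eq_iff hπ]
    generalize algebraMap GaussianInt N ι = I at *
    generalize algebraMap GaussianInt N c = C at *
    have q1 : (1 - I) * (1 + I) = 2 := by linear_combination -hI
    have q2 : (2 + I) * (1 + I) = 1 + 3 * I := by linear_combination hI
    linear_combination hq + he' - ((2 - I) * β ^ 3 + C * β ^ 2 + C * β) * q1 - β ^ 2 * q2
  obtain ⟨γ, hγ, hγi⟩ : ∃ γ : N, (1 + algebraMap GaussianInt N ι) * γ =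
      β ^ 2 + β + algebraMap GaussianInt N c ∧ IsIntegral GaussianInt γ :=
    ⟨_, by field_simp, hwi⟩
  -- Since (1 + ι)² = 2ι, squaring (1 + ι)γ = β² + β + c gives 2ιγ² on the left; eliminating β⁴ by
  -- the quartic writes c² - 3ιc as twice an integral element.
  have hfin : 2 ∣ c ^ 2 - 3 * ι * c := by
    refine dvd_of_isIntegral_div K (N := N) (by decide) (isIntegral_of_eq
      (((((hii.mul (hγi.pow 2)).sub ((i2.sub hii).mul (hβi.pow 3))).sub
        ((hci c).mul (hβi.pow 2))).sub ((hci c).mul hβi)).sub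
        (hii.mul (((i2.add hii).mul hγi).sub ((i2.sub hii).mul hβi)))) ?_)
    simp only [map_sub, map_mul, map_pow, map_ofNat]
    rw [div_eq_iff h2]
    generalize algebraMap GaussianInt N ι = I at *
    generalize algebraMap GaussianInt N c = C at *
    clear hπ h2 h4 he' hβ hα hR hR4
    have e1 : 2 * I * γ ^ 2 = (β ^ 2 + β + C) ^ 2 := by
      rw [← hγ]; linear_combination -γ ^ 2 * hI
    have e2 : 2 * I * γ = (1 + I) * (β ^ 2 + β + C) := by
      rw [← hγ]; linear_combination -γ * hI
    linear_combination -e1 + (2 + I) * e2 - hq + (β ^ 2 + 3 * β + C) * hI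
  rcases two_dvd_or_two_dvd_sub_ι (c := c) (by
    obtain ⟨t, ht⟩ := hfin
    exact ⟨-t - 2 * ι * c, by linear_combination -ht⟩) with ⟨t, ht⟩ | ⟨t, ht⟩
  · exact Or.inl ⟨-t, by linear_combination -hc - 4 * ht⟩
  · exact Or.inr ⟨-t - ι, by linear_combination -hc - 4 * ht⟩

end QuarticKummer

/-! ### The main theorem -/

open QuarticKummer in
theorem mainTheorem2 {K N : Type*} [Field K] [Algebra GaussianInt K] [IsFractionRing GaussianInt K]
    [Field N] [Algebra K N] [Algebra GaussianInt N] [IsScalarTower GaussianInt K N]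
    (f g h m : GaussianInt)
    (hf : Squarefree f) (hg : Squarefree g) (hh : Squarefree h)
    (hfg : IsCoprime f g) (hfh : IsCoprime f h) (hgh : IsCoprime g h)
    (hm : m = f * g ^ 2 * h ^ 3)
    (α : N) (hα : α ^ 4 = algebraMap GaussianInt N m)
    (hN : IntermediateField.adjoin K {α} = ⊤) (hdeg : Module.finrank K N = 4) :
    (QuarticKummer.IsUnramifiedOver N (Ideal.span {1 + QuarticKummer.ι}) ↔
      (8 ∣ m - 1 ∨ 8 ∣ m - (1 + 4 * QuarticKummer.ι))) ∧
    (8 ∣ m - 1 →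
      QuarticKummer.IsIntegralBasis (QuarticKummer.basisOne g h α) ∧
      Algebra.discr K (QuarticKummer.basisOne g h α) =
        algebraMap GaussianInt K (f ^ 3 * g ^ 2 * h ^ 3)) ∧
    (8 ∣ m - (1 + 4 * QuarticKummer.ι) →
      QuarticKummer.IsIntegralBasis (QuarticKummer.basisTwo g h α) ∧
      Algebra.discr K (QuarticKummer.basisTwo g h α) =
        algebraMap GaussianInt K (f ^ 3 * g ^ 2 * h ^ 3)) ∧
    (8 ∣ m - 1 ∨ 8 ∣ m - (1 + 4 * QuarticKummer.ι) →
      QuarticKummer.relDiscr N K = Ideal.span {f ^ 3 * g ^ 2 * h ^ 3}) := by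
  have : FaithfulSMul GaussianInt N := FaithfulSMul.trans GaussianInt K N
  have : FiniteDimensional K N := Module.finite_of_finrank_pos (by omega)
  -- The discriminant divides m³ with cofactor g⁴h⁶, and m is odd. The case r = 0 covers m ≡ 1 mod
  -- 8.
  have hodd : ∀ r, 8 ∣ m - (1 + 4 * r) → ¬ (1 + ι) ∣ f ^ 3 * g ^ 2 * h ^ 3 := by
    intro r hr hd
    refine not_one_add_ι_dvd_of_eight_dvd hr
      (prime_one_add_ι.dvd_of_dvd_pow (n := 3) (hd.trans ⟨g ^ 4 * h ^ 6, ?_⟩))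
    rw [hm]; ring
  have hdiscr := fun r s => discr_triangularFamily hg.ne_zero hh.ne_zero hm hα hN hdeg r s
  have hfour := fun r s x (hx : IsIntegral GaussianInt x) =>
    four_smul_mem_span (x := x) hf hg hh hfg hfh hgh hm hα hN hdeg r s hx
  have zero_case : 8 ∣ m - 1 → 8 ∣ m - (1 + 4 * 0) := fun h => by simpa using h
  have main : ∀ r s, ¬ (1 + ι) ∣ f ^ 3 * g ^ 2 * h ^ 3 →
      (∀ j, IsIntegral GaussianInt (triangularFamily g h r s α j)) →
      IsUnramifiedOver N (Ideal.span {1 + ι}) ∧ IsIntegralBasis (triangularFamily g h r s α) ∧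
        relDiscr N K = Ideal.span {f ^ 3 * g ^ 2 * h ^ 3} := by
    intro r s hd hint
    have hli := linearIndependent_of_discr_eq
      (fun h0 => hd (by rw [h0]; exact dvd_zero _)) (hdiscr r s)
    have hspan : ∀ x, IsIntegral GaussianInt x →
        x ∈ Submodule.span GaussianInt (Set.range (triangularFamily g h r s α)) := fun x hx =>
      mem_span_of_isIntegral hdeg hint hd (hdiscr r s) (hfour r s) hx
    exact ⟨(isUnramifiedOver_span_iff K prime_one_add_ι).2 fun x hx hx2 =>
        isIntegral_div_of_isIntegral_sq_div hα hN hdeg hint hd (hdiscr r s) hx hx2,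
      isIntegralBasis_of_mem_span hint hli hspan,
      relDiscr_eq_span hdeg hint hli hspan (hdiscr r s)⟩
  have one : 8 ∣ m - 1 → _ := fun h1 => main _ _ (hodd 0 (zero_case h1)) fun j => by
    rw [← basisOne_eq]; exact isIntegral_basisOne hm hα h1 j
  have two : 8 ∣ m - (1 + 4 * ι) → _ := fun h1 => main _ _ (hodd ι h1) fun j => by
    rw [← basisTwo_eq]; exact isIntegral_basisTwo hm hα h1 j
  refine ⟨⟨fun hu => ?_, fun h1 => h1.elim (fun h1 => (one h1).1) fun h1 => (two h1).1⟩,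
    fun h1 => ?_, fun h1 => ?_, fun h1 => h1.elim (fun h1 => (one h1).2.2) fun h1 => (two h1).2.2⟩
  · refine eight_dvd_of_radical K ?_ hα ((isUnramifiedOver_span_iff K prime_one_add_ι).1 hu)
    rw [hm]
    exact not_prime_pow_four_dvd hf hg hh hfg hfh hgh prime_one_add_ι
  · rw [basisOne_eq]
    exact ⟨(one h1).2.1, hdiscr _ _⟩
  · rw [basisTwo_eq]
    exact ⟨(two h1).2.1, hdiscr _ _⟩
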